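/- Let $\mathbf H$ be a complex Hilbert space and let $L$ be a non-negative self-adjoint (in general unbounded) operator in $\mathbf H$. For $s\ge 0$ let $\mathbf H^{s}$ be the domain of $L^{s/2}$ with the norm $\|f\|_{\mathbf H}+\|L^{s/2}f\|_{\mathbf H}$. For $\omega>0$ let $\mathbf{PW}_\omega(\sqrt L)$ be the closed subspace of all vectors whose spectral transform with respect to $\sqrt L$ is supported in $[0,\omega]$, and let $\mathcal P_\omega$ be the orthogonal projection of $\mathbf H$ onto it. Sampling assumption: let $0\le m_0<m$ and $c,C>0$, and suppose that for each $\rho\in(0,1)$ there is given a family $\{\mathcal A^{(\rho)}_k\}_{k\in\mathcal K_\rho}$ of linear functionals on $\mathbf H^{m_0}$ such that for all $f\in\mathbf H^{m}$ $$c\sum_{k}|\mathcal A^{(\rho)}_k(f)|^2\le\|f\|_{\mathbf H}^2\le C\Big(\sum_k|\mathcal A^{(\rho)}_k(f)|^2+\rho^{2m}\|L^{m/2}f\|_{\mathbf H}^2\Big).$$ By the first inequality each $\mathcal A^{(\rho)}_k$ is represented on $\mathbf H^m$ by a unique vector $\mu^{(\rho)}_k\in\mathbf H$, that is, $\langle f,\mu^{(\rho)}_k\rangle=\mathcal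 A^{(\rho)}_k(f)$ for $f\in\mathbf H^m$. Let $g$ be a non-increasing $C^\infty$ function on $[0,\infty)$ with $0\le g\le1$, $g=1$ on $[0,1]$ and $\operatorname{supp} g\subset[0,2]$. Put $h(\lambda)=g(\lambda)-g(2\lambda)$, $F_0=\sqrt{g}$ and $F_j(\lambda)=\sqrt{h(2^{-j}\lambda)}$ for $j\ge1$. Fix $\delta\in(0,1)$, and for each $j\ge 0$ let $\rho_j\in(0,1)$ be such that $\rho_j^{2m}=C^{-1}(2^{j+1})^{-2m}\delta$. The Paley–Wiener frame vectors are $$\Phi^j_k=F_j(\sqrt L)\,\mathcal P_{2^{j+1}}\mu^{(\rho_j)}_k,\qquad j\ge0,\ k\in\mathcal K_{\rho_j}.$$ For $\alpha>0$, $1\le q\le\infty$ and an integer $r>\alpha$ let $\mathcal B^\alpha_{\mathbf H,q}(\sqrt L)=(\mathbf H,\mathbf H^r)^K_{\alpha/r,q}$, with the norm $$\|f\|_{\mathcal B^\alpha_{\mathbf H,q}}=\Big(\int_0^\infty\big(t^{-\alpha/r}K(f,t)\big)^q\frac{dt}{t}\Big)^{1/q},\qquad K(f,t)=\inf_{f=f_0+f_1}\big(\|f_0\|_{\mathbf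 H}+t\|f_1\|_{\mathbf H^r}\big),$$ where the infimum is over $f_0\in\mathbf H$, $f_1\in\mathbf H^r$, and the integral is replaced by $\sup_{t>0}t^{-\alpha/r}K(f,t)$ if $q=\infty$. Theorem. There are constants $c_1,c_2>0$ such that for all $f\in\mathbf H$ $$c_1\|f\|_{\mathcal B^\alpha_{\mathbf H,q}}\le\Big(\sum_{j=0}^\infty2^{j\alpha q}\Big(\sum_{k}|\langle f,\Phi^j_k\rangle|^2\Big)^{q/2}\Big)^{1/q}\le c_2\|f\|_{\mathcal B^\alpha_{\mathbf H,q}},$$ where for $q=\infty$ the middle term is $\sup_{j\ge0}2^{j\alpha}\big(\sum_k|\langle f,\Phi^j_k\rangle|^2\big)^{1/2}$. Both norms may take the value $+\infty$; in particular, $f\in\mathcal B^\alpha_{\mathbf H,q}(\sqrt L)$ if and only if the middle term is finite. -/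

import Mathlib

open scoped ENNReal

noncomputable section

namespace PaleyWiener

variable {H : Type*} [NormedAddCommGroup H] [InnerProductSpace ℂ H] [CompleteSpace H]

/-! ### Functional calculus of `√L`

Throughout, `L` is a non-negative self-adjoint operator, given as a `LinearPMap`. -/

/-- `L` is a non-negative self-adjoint (in general unbounded) operator. Self-adjointness of a
`LinearPMap` in Mathlib includes density of the domain. -/
structure IsNonnegSelfAdjoint (L : H →ₗ.[ℂ] H) : Prop where
  isSelfAdjoint : IsSelfAdjoint L
  nonneg : ∀ x : L.domain, 0 ≤ (inner ℂ (L x) (x : H)).re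

/-- `R` is the bounded inverse of `I + L`: for every `f`, `u = R f` lies in the domain of `L` and
solves `u + L u = f`. -/
def IsResolvent (L : H →ₗ.[ℂ] H) (R : H →L[ℂ] H) : Prop :=
  ∀ f : H, ∃ hu : R f ∈ L.domain, R f + L ⟨R f, hu⟩ = f

theorem norm_le_norm_add {L : H →ₗ.[ℂ] H} (hL : IsNonnegSelfAdjoint L) (x : L.domain) :
    ‖(x : H)‖ ≤ ‖(x : H) + L x‖ := by
  have h1 : ‖(x : H)‖ ^ 2 ≤ (inner ℂ ((x : H) + L x) (x : H)).re := by
    rw [inner_add_left, Complex.add_re]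
    have h2 : (inner ℂ (x : H) (x : H)).re = ‖(x : H)‖ ^ 2 := by
      have := inner_self_eq_norm_sq (𝕜 := ℂ) (x : H)
      simpa using this
    have := hL.nonneg x
    linarith
  have h3 : (inner ℂ ((x : H) + L x) (x : H)).re ≤ ‖(x : H) + L x‖ * ‖(x : H)‖ :=
    (Complex.re_le_norm _).trans (norm_inner_le_norm _ _)
  rcases (norm_nonneg (x : H)).eq_or_lt with h | h
  · rw [← h]; positivity
  · nlinarith

/-- The bounded inverse of `I + L` (it exists and is unique, see `isResolvent_resolvent`). -/
def resolvent (L : H →ₗ.[ℂ] H) : H →L[ℂ] H :=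
  open Classical in if h : ∃ R : H →L[ℂ] H, IsResolvent L R then h.choose else 0

theorem isResolvent_resolvent {L : H →ₗ.[ℂ] H} (hL : IsNonnegSelfAdjoint L) :
    IsResolvent L (resolvent L) := by
  have hsa : L.adjoint = L := hL.isSelfAdjoint
  have hdense : Dense (L.domain : Set H) := hL.isSelfAdjoint.dense_domain
  have hclosed : IsClosed (L.graph : Set (H × H)) := hL.isSelfAdjoint.isClosed
  let B : L.domain →ₗ[ℂ] H := L.domain.subtype + L.toFun
  have hB : ∀ x : L.domain, B x = (x : H) + L x := fun x => rfl
  have hbound : ∀ x : L.domain, ‖(x : H)‖ ≤ ‖B x‖ := fun x => norm_le_norm_add hL x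
  have hrange : IsClosed (LinearMap.range B : Set H) := by
    refine IsSeqClosed.isClosed fun y z hy hz => ?_
    choose x hx using hy
    have hcs : CauchySeq fun n => ((x n : L.domain) : H) := by
      have h1 := hz.cauchySeq
      rw [Metric.cauchySeq_iff] at h1 ⊢
      intro ε hε
      obtain ⟨N, hN⟩ := h1 ε hε
      refine ⟨N, fun m hm n hn => lt_of_le_of_lt ?_ (hN m hm n hn)⟩
      have h2 := hbound (x m - x n)
      rw [map_sub, hx, hx] at h2
      simpa [dist_eq_norm] using h2
    obtain ⟨u, hu⟩ := cauchySeq_tendsto_of_complete hcs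
    have hLx : Filter.Tendsto (fun n => L (x n)) Filter.atTop (nhds (z - u)) := by
      refine (hz.sub hu).congr fun n => ?_
      rw [← hx n, hB]; abel
    have hmem : (u, z - u) ∈ (L.graph : Set (H × H)) :=
      hclosed.mem_of_tendsto (hu.prodMk_nhds hLx)
        (Filter.Eventually.of_forall fun n => L.mem_graph (x n))
    obtain ⟨v, hv1, hv2⟩ := (LinearPMap.mem_graph_iff L).1 hmem
    refine ⟨v, ?_⟩
    rw [hB, hv1, hv2]; exact add_sub_cancel u z
  have hsurj : LinearMap.range B = ⊤ := by
    have : CompleteSpace (LinearMap.range B) := hrange.completeSpace_coe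
    rw [← Submodule.orthogonal_eq_bot_iff, Submodule.eq_bot_iff]
    intro v hv
    have hv' : ∀ x : L.domain, inner ℂ (-v) (x : H) = inner ℂ v (L x) := by
      intro x
      have h1 := (Submodule.mem_orthogonal' _ _).1 hv (B x) ⟨x, rfl⟩
      rw [hB, inner_add_right] at h1
      rw [inner_neg_left]
      linear_combination -h1
    have hmem : v ∈ L.adjoint.domain := L.mem_adjoint_domain_of_exists v ⟨-v, hv'⟩
    have happ : L.adjoint ⟨v, hmem⟩ = -v := LinearPMap.adjoint_apply_eq hdense ⟨v, hmem⟩ hv'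
    have key : ∀ M : H →ₗ.[ℂ] H, M = L → ∀ h : v ∈ M.domain, M ⟨v, h⟩ = -v → v = 0 := by
      rintro M rfl h h2
      have h3 := hbound ⟨v, h⟩
      rw [hB, h2] at h3
      simpa using h3
    exact key _ hsa hmem happ
  have hinj : ∀ x y : L.domain, B x = B y → x = y := by
    intro x y hxy
    have h1 := hbound (x - y)
    rw [map_sub, hxy, sub_self, norm_zero] at h1
    exact Subtype.ext (sub_eq_zero.1 (by simpa using h1))
  let e : L.domain ≃ₗ[ℂ] H := LinearEquiv.ofBijective B ⟨fun x y => hinj x y, LinearMap.range_eq_top.1 hsurj⟩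
  have he : ∀ f, B (e.symm f) = f := fun f => e.apply_symm_apply f
  let R : H →L[ℂ] H := (L.domain.subtype ∘ₗ e.symm.toLinearMap).mkContinuous 1 (by
    intro f
    have := hbound (e.symm f)
    rw [he] at this
    simpa using this)
  have hex : ∃ R : H →L[ℂ] H, IsResolvent L R := ⟨R, fun f => ⟨(e.symm f).2, he f⟩⟩
  rw [resolvent, dif_pos hex]
  exact hex.choose_spec

/-- The operator `φ(√L)` for a continuous function `φ` of compact support (only the values of `φ`
on `[0, ∞)` matter). If `λ ≥ 0` is a spectral value of `√L`, then `x = 1 / (1 + λ ^ 2) ∈ (0, 1]` is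
the corresponding spectral value of `(I + L)⁻¹`, and `λ = √(1 / x - 1)`. Hence `φ(√L)` is the
continuous function `x ↦ φ (√(1 / x - 1))`, extended by `0` to `x ≤ 0`, of the bounded self-adjoint
operator `(I + L)⁻¹`. -/
def fnSqrt (L : H →ₗ.[ℂ] H) (φ : ℝ → ℝ) : H →L[ℂ] H :=
  cfc (fun x : ℝ => if 0 < x then φ (√(x⁻¹ - 1)) else 0) (resolvent L)

/-- The graph of the power `L ^ (s / 2) = (√L) ^ s`, `s ≥ 0`: the pairs `(f, h)` such that the
spectral Fourier transforms satisfy `(𝓕 h)(λ) = λ ^ s (𝓕 f)(λ)`, tested against all continuous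
functions of compact support. -/
def sqrtPowGraph (L : H →ₗ.[ℂ] H) (s : ℝ) : Submodule ℂ (H × H) where
  carrier := {p | ∀ φ : ℝ → ℝ, Continuous φ → HasCompactSupport φ →
    fnSqrt L φ p.2 = fnSqrt L (fun l => l ^ s * φ l) p.1}
  add_mem' := by
    intro a b ha hb φ h1 h2
    simp [ha φ h1 h2, hb φ h1 h2]
  zero_mem' := by
    intro φ _ _
    simp
  smul_mem' := by
    intro c a ha φ h1 h2
    simp [ha φ h1 h2]

/-- The operator `L ^ (s / 2) = (√L) ^ s`, `s ≥ 0`, with its natural domain. -/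
def sqrtPow (L : H →ₗ.[ℂ] H) (s : ℝ) : H →ₗ.[ℂ] H := (sqrtPowGraph L s).toLinearPMap

/-- The Paley-Wiener space `PW_ω(√L)`: the vectors whose spectral Fourier transform has its support
in `[0, ω]`, i.e. is annihilated by every continuous function of compact support that vanishes on
`[0, ω]`. -/
def paleyWiener (L : H →ₗ.[ℂ] H) (ω : ℝ) : Submodule ℂ H where
  carrier := {f | ∀ φ : ℝ → ℝ, Continuous φ → HasCompactSupport φ →
    (∀ l ∈ Set.Icc 0 ω, φ l = 0) → fnSqrt L φ f = 0}
  add_mem' := by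
    intro a b ha hb φ h1 h2 h3
    simp [ha φ h1 h2 h3, hb φ h1 h2 h3]
  zero_mem' := by
    intro φ _ _ _
    simp
  smul_mem' := by
    intro c a ha φ h1 h2 h3
    simp [ha φ h1 h2 h3]

theorem isClosed_paleyWiener (L : H →ₗ.[ℂ] H) (ω : ℝ) :
    IsClosed (paleyWiener L ω : Set H) := by
  have : (paleyWiener L ω : Set H) = ⋂ (φ : ℝ → ℝ) (_ : Continuous φ) (_ : HasCompactSupport φ)
      (_ : ∀ l ∈ Set.Icc 0 ω, φ l = 0), {f | fnSqrt L φ f = 0} := by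
    ext f
    simp only [Set.mem_iInter]
    rfl
  rw [this]
  refine isClosed_iInter fun φ => isClosed_iInter fun _ => isClosed_iInter fun _ =>
    isClosed_iInter fun _ => isClosed_eq (fnSqrt L φ).continuous continuous_const

instance completeSpace_paleyWiener (L : H →ₗ.[ℂ] H) (ω : ℝ) : CompleteSpace (paleyWiener L ω) :=
  (isClosed_paleyWiener L ω).completeSpace_coe

/-! ### Besov spaces -/

/-- The graph norm `‖f‖ + ‖L ^ (s / 2) f‖` of `H ^ s`, the domain of `L ^ (s / 2)`, with the value
`∞` outside this domain. -/
def sobolevNorm (L : H →ₗ.[ℂ] H) (s : ℝ) (f : H) : ℝ≥0∞ :=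
  open Classical in
  if hf : f ∈ (sqrtPow L s).domain then ‖f‖ₑ + ‖sqrtPow L s ⟨f, hf⟩‖ₑ else ∞

/-- Peetre's `K`-functional of a pair of spaces inside `V`, each given by its norm with the value
`∞` outside the space. -/
def kFunctional {V : Type*} [AddCommGroup V] (nE nF : V → ℝ≥0∞) (f : V) (t : ℝ) : ℝ≥0∞ :=
  ⨅ (p : V × V) (_ : p.1 + p.2 = f), nE p.1 + ENNReal.ofReal t * nF p.2

/-- The norm of the real interpolation space `(E, F)^K_{θ, q}`, with the value `∞` outside. -/
def interpolationNorm {V : Type*} [AddCommGroup V] (nE nF : V → ℝ≥0∞) (θ : ℝ) (q : ℝ≥0∞)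
    (f : V) : ℝ≥0∞ :=
  open Classical in
  if q = ∞ then ⨆ t ∈ Set.Ioi (0 : ℝ), ENNReal.ofReal (t ^ (-θ)) * kFunctional nE nF f t
  else (∫⁻ t in Set.Ioi (0 : ℝ),
    (ENNReal.ofReal (t ^ (-θ)) * kFunctional nE nF f t) ^ q.toReal * ENNReal.ofReal t⁻¹) ^
      (1 / q.toReal)

/-- The norm of the Besov space `B^α_{H,q}(√L) = (H, H ^ r)^K_{α / r, q}`, `0 < α < r`, with the
value `∞` outside this space. -/
def besovNorm (L : H →ₗ.[ℂ] H) (r : ℕ) (α : ℝ) (q : ℝ≥0∞) (f : H) : ℝ≥0∞ :=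
  interpolationNorm (fun f : H => ‖f‖ₑ) (sobolevNorm L r) (α / r) q f

/-! ### Paley-Wiener frames -/

/-- Generating functions `g` of a dyadic partition of unity on `[0, ∞)`. -/
structure IsCutoff (g : ℝ → ℝ) : Prop where
  contDiffOn : ContDiffOn ℝ ((⊤ : ℕ∞) : WithTop ℕ∞) g (Set.Ici 0)
  antitoneOn : AntitoneOn g (Set.Ici 0)
  eq_one : ∀ l ∈ Set.Icc (0 : ℝ) 1, g l = 1
  eq_zero : ∀ l, 2 < l → g l = 0
  mem_Icc : ∀ l, 0 ≤ l → g l ∈ Set.Icc (0 : ℝ) 1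

/-- The quadratic dyadic partition of unity: `F₀(λ) = √(g(λ))`, `F_j(λ) = √(h(2⁻ʲ λ))` for `j ≥ 1`,
where `h(λ) = g(λ) - g(2 λ)`. -/
def quadPartition (g : ℝ → ℝ) (j : ℕ) (l : ℝ) : ℝ :=
  if j = 0 then √(g l) else √(g (l / 2 ^ j) - g (2 * (l / 2 ^ j)))

/-- The sampling assumption: for each `ρ ∈ (0, 1)` there is a family of linear functionals
`A ρ k`, `k ∈ K ρ`, on `H ^ m₀` such that
`c ∑ₖ |A ρ k f|² ≤ ‖f‖² ≤ C (∑ₖ |A ρ k f|² + ρ ^ (2 m) ‖L ^ (m / 2) f‖²)` for all `f ∈ H ^ m`.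
For `m ≥ m₀` one has `H ^ m ⊆ H ^ m₀`. -/
def IsSamplingFamily (L : H →ₗ.[ℂ] H) (m₀ m c C : ℝ) {K : ℝ → Type*}
    (A : ∀ ρ : ℝ, K ρ → (sqrtPow L m₀).domain →ₗ[ℂ] ℂ) : Prop :=
  ∀ ρ ∈ Set.Ioo (0 : ℝ) 1, ∀ f : (sqrtPow L m₀).domain, ∀ hf : (f : H) ∈ (sqrtPow L m).domain,
    ENNReal.ofReal c * ∑' k, ‖A ρ k f‖ₑ ^ 2 ≤ ‖(f : H)‖ₑ ^ 2 ∧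
    ‖(f : H)‖ₑ ^ 2 ≤ ENNReal.ofReal C *
      (∑' k, ‖A ρ k f‖ₑ ^ 2 + ENNReal.ofReal (ρ ^ (2 * m)) * ‖sqrtPow L m ⟨f, hf⟩‖ₑ ^ 2)

/-- The vector `μ ∈ H` represents the functional `a` on `H ^ m`, `m > m₀`: `⟨f, μ⟩ = a f`.
(Mathlib's inner product is linear in its second argument.) -/
def Represents (L : H →ₗ.[ℂ] H) (m₀ m : ℝ) (a : (sqrtPow L m₀).domain →ₗ[ℂ] ℂ) (μ : H) : Prop :=
  ∀ f : (sqrtPow L m₀).domain, (f : H) ∈ (sqrtPow L m).domain → inner ℂ μ (f : H) = a f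

/-- The vector that represents `a` on `H ^ m`. As `H ^ m` is dense in `H`, it is unique, and it
exists if `a` is bounded on `H ^ m` in the norm of `H`. -/
def representer (L : H →ₗ.[ℂ] H) (m₀ m : ℝ) (a : (sqrtPow L m₀).domain →ₗ[ℂ] ℂ) : H :=
  open Classical in if h : ∃ μ, Represents L m₀ m a μ then h.choose else 0

/-- `φ_k^ω = P_ω μ_k`, where `P_ω` is the orthogonal projection of `H` onto `PW_ω(√L)` and
`μ_k` represents the functional `a`. -/
def samplingVector (L : H →ₗ.[ℂ] H) (m₀ m : ℝ) (ω : ℝ)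
    (a : (sqrtPow L m₀).domain →ₗ[ℂ] ℂ) : H :=
  (paleyWiener L ω).starProjection (representer L m₀ m a)

/-- The Paley-Wiener frame vectors `Φ_k^j = F_j(√L) φ_k^j`, where `φ_k^j` belongs to
`ω = 2 ^ (j + 1)`. -/
def frameVector (L : H →ₗ.[ℂ] H) (m₀ m : ℝ) (g : ℝ → ℝ) (j : ℕ)
    (a : (sqrtPow L m₀).domain →ₗ[ℂ] ℂ) : H :=
  fnSqrt L (quadPartition g j) (samplingVector L m₀ m (2 ^ (j + 1)) a)

/-- `(∑_j (2 ^ (j α) (∑_k |⟨f, Φ j k⟩|²) ^ (1/2)) ^ q) ^ (1/q)`, a supremum over `j` if `q = ∞`. -/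
def coefficientNorm {K : ℕ → Type*} (Φ : ∀ j, K j → H) (α : ℝ) (q : ℝ≥0∞) (f : H) : ℝ≥0∞ :=
  open Classical in
  if q = ∞ then
    ⨆ j : ℕ, ENNReal.ofReal (2 ^ (j * α)) * (∑' k, ‖inner ℂ (Φ j k) f‖ₑ ^ 2) ^ (1 / 2 : ℝ)
  else
    (∑' j : ℕ, ENNReal.ofReal (2 ^ (j * α * q.toReal)) *
      (∑' k, ‖inner ℂ (Φ j k) f‖ₑ ^ 2) ^ (q.toReal / 2)) ^ (1 / q.toReal)

end PaleyWiener

end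

/-!
Both sides are compared with the `ℓ^q` norm of the weighted dyadic pieces `2^(jα) ‖F_j(√L) f‖`
(`weightedPart`), where `(F_j)` is the quadratic dyadic partition of unity.

The spectral theory needed is a small calculus of `φ(√L)` for test functions `φ`: it is
multiplicative and contractive for the sup norm, because it is the continuous functional calculus of
the bounded self-adjoint operator `(I + L)⁻¹`. As `(I + L)⁻¹` is injective, it has dense range, and
on this range spectral cutoffs converge to the identity (`tendsto_fnSqrt_cutoff`). Hence the graphs
of the powers of `√L` are single-valued, and the reproducing formula `f = ∑ F_j(√L)² f` holds
(`tendsto_sum_dyadicPart`).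

*Sampling.* The piece `F_j(√L) f` has spectrum in `[0, 2^(j+1)]`, so it is fixed by the
Paley-Wiener projection, and its samples are the frame coefficients `⟨f, Φ_k^j⟩`
(`inner_frameVector`). By the Bernstein inequality with its sharp constant and the choice of `ρ_j`,
the error term of the sampling inequality is at most `δ ‖F_j(√L) f‖²` with `δ < 1`, and can be
absorbed. So the coefficients of order `j` have an `ℓ²` norm equivalent to `‖F_j(√L) f‖`, with
constants independent of `j` (`tsum_inner_frameVector`).

*Interpolation.* Put `K_n = K(f, 2^(-nr))`. Applying `F_j(√L)` to both parts of a decomposition of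
`f` gives `‖F_j(√L) f‖ ≤ 2^r K_j` (`enorm_dyadicPart_le_kFunctional`). Conversely, cutting the
reproducing formula at order `n` bounds `2^(nα) K_n` by a sum of the `2^(jα) ‖F_j(√L) f‖` whose
kernel decays like `2^(-α|n-j|)` for `j > n` and like `2^(-(r-α)|n-j|)` for `j ≤ n`
(`mul_kFunctional_le_tsum`). By the Schur test such a kernel is bounded on `ℓ^q`. Finally, `K(f, t)`
is nondecreasing and `K(f, t) / t` nonincreasing in `t`, so the interpolation norm is equivalent to
the `ℓ^q` norm of `2^(nα) K_n`, `n ≥ 0`, once large `t` are handled by `K(f, t) ≤ ‖f‖`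
(`exists_lqNorm_kFunctional_le`, `exists_interpolationNorm_le`).
-/

open scoped ENNReal

namespace PaleyWiener

/-! ### Sequence norms -/

/-- The norm of `ℓ^q` on sequences of values in `[0, ∞]`. -/
noncomputable def lqNorm (q : ℝ≥0∞) (y : ℕ → ℝ≥0∞) : ℝ≥0∞ :=
  open Classical in
  if q = ∞ then ⨆ n, y n else (∑' n, y n ^ q.toReal) ^ (1 / q.toReal)

theorem lqNorm_top (y : ℕ → ℝ≥0∞) : lqNorm ∞ y = ⨆ n, y n := if_pos rfl

theorem lqNorm_of_ne_top {q : ℝ≥0∞} (hq : q ≠ ∞) (y : ℕ → ℝ≥0∞) :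
    lqNorm q y = (∑' n, y n ^ q.toReal) ^ (1 / q.toReal) := if_neg hq

theorem one_le_toReal {q : ℝ≥0∞} (h1 : 1 ≤ q) (hq : q ≠ ∞) : 1 ≤ q.toReal := by
  simpa using ENNReal.toReal_mono hq h1

theorem mul_rpow_one_div {a x : ℝ≥0∞} {p : ℝ} (hp : 0 < p) :
    (a ^ p * x) ^ (1 / p) = a * x ^ (1 / p) := by
  rw [ENNReal.mul_rpow_of_nonneg _ _ (by positivity), one_div, ENNReal.rpow_rpow_inv hp.ne']

theorem lqNorm_mono {q : ℝ≥0∞} {y z : ℕ → ℝ≥0∞} (h : ∀ n, y n ≤ z n) :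
    lqNorm q y ≤ lqNorm q z := by
  rcases eq_or_ne q ∞ with rfl | hq
  · rw [lqNorm_top, lqNorm_top]
    exact iSup_mono h
  · rw [lqNorm_of_ne_top hq, lqNorm_of_ne_top hq]
    gcongr with n
    exact h n

theorem lqNorm_const_mul {q : ℝ≥0∞} (h1 : 1 ≤ q) (a : ℝ≥0∞) (y : ℕ → ℝ≥0∞) :
    lqNorm q (fun n => a * y n) = a * lqNorm q y := by
  rcases eq_or_ne q ∞ with rfl | hq
  · rw [lqNorm_top, lqNorm_top, ENNReal.mul_iSup]
  · have hp := one_le_toReal h1 hq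
    rw [lqNorm_of_ne_top hq, lqNorm_of_ne_top hq]
    simp_rw [ENNReal.mul_rpow_of_nonneg _ _ (zero_le_one.trans hp)]
    rw [ENNReal.tsum_mul_left, mul_rpow_one_div (by linarith)]

/-- Weighted Jensen inequality for sums of weights of total mass at most `M`. -/
theorem tsum_mul_rpow_le {p : ℝ} (hp : 1 ≤ p) {w y : ℕ → ℝ≥0∞} {M : ℝ≥0∞} (hM : ∑' j, w j ≤ M) :
    (∑' j, w j * y j) ^ p ≤ M ^ (p - 1) * ∑' j, w j * y j ^ p := by
  have hp0 : 0 < p := by linarith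
  have h1 : ∑' j, w j * y j ≤ M ^ (1 - p⁻¹) * (∑' j, w j * y j ^ p) ^ p⁻¹ := by
    rw [ENNReal.tsum_eq_iSup_sum]
    refine iSup_le fun s => (ENNReal.inner_le_weight_mul_Lp_of_nonneg s hp w y).trans ?_
    have : 0 ≤ 1 - p⁻¹ := sub_nonneg.2 (inv_le_one_of_one_le₀ hp)
    gcongr
    · exact (ENNReal.sum_le_tsum s).trans hM
    · exact ENNReal.sum_le_tsum s
  refine (ENNReal.rpow_le_rpow h1 hp0.le).trans_eq ?_
  rw [ENNReal.mul_rpow_of_nonneg _ _ hp0.le, ENNReal.rpow_inv_rpow hp0.ne', ← ENNReal.rpow_mul]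
  congr 2
  field_simp

/-- Schur test on `ℓ^q`. -/
theorem lqNorm_tsum_mul_le {q : ℝ≥0∞} (h1 : 1 ≤ q) {κ : ℕ → ℕ → ℝ≥0∞} {M : ℝ≥0∞}
    (hrow : ∀ n, ∑' j, κ n j ≤ M) (hcol : ∀ j, ∑' n, κ n j ≤ M) (y : ℕ → ℝ≥0∞) :
    lqNorm q (fun n => ∑' j, κ n j * y j) ≤ M * lqNorm q y := by
  rcases eq_or_ne q ∞ with rfl | hq
  · rw [lqNorm_top, lqNorm_top]
    refine iSup_le fun n => ?_
    calc ∑' j, κ n j * y j ≤ ∑' j, κ n j * ⨆ i, y i := by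
          gcongr with j
          exact le_iSup y j
      _ = (∑' j, κ n j) * ⨆ i, y i := ENNReal.tsum_mul_right
      _ ≤ _ := by gcongr; exact hrow n
  · have hp := one_le_toReal h1 hq
    rw [lqNorm_of_ne_top hq, lqNorm_of_ne_top hq]
    set p := q.toReal
    rw [← mul_rpow_one_div (by linarith)]
    gcongr
    calc ∑' n, (∑' j, κ n j * y j) ^ p ≤ ∑' n, M ^ (p - 1) * ∑' j, κ n j * y j ^ p := by
          gcongr with n
          exact tsum_mul_rpow_le hp (hrow n)
      _ = M ^ (p - 1) * ∑' j, (∑' n, κ n j) * y j ^ p := by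
          rw [ENNReal.tsum_mul_left, ENNReal.tsum_comm]
          simp_rw [ENNReal.tsum_mul_right]
      _ ≤ M ^ (p - 1) * ∑' j, M * y j ^ p := by
          gcongr with j
          exact hcol j
      _ = M ^ p * ∑' j, y j ^ p := by
          rw [ENNReal.tsum_mul_left, ← mul_assoc]
          congr 1
          nth_rw 2 [← ENNReal.rpow_one M]
          rw [← ENNReal.rpow_add_of_nonneg _ _ (by linarith) zero_le_one, sub_add_cancel]

theorem tsum_pow_dist_le (β : ℝ≥0∞) (n : ℕ) : ∑' j, β ^ Nat.dist n j ≤ 2 * (1 - β)⁻¹ := by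
  -- Sum over the distance `i` first: at most two `j` have distance `i` from `n`.
  have h1 : ∀ j, β ^ Nat.dist n j ≤
      ∑' i, β ^ i * ((if j = n + i then 1 else 0) + if j = n - i then 1 else 0) := by
    intro j
    refine le_trans ?_ (ENNReal.le_tsum (Nat.dist n j))
    rcases le_total n j with h | h
    · rw [Nat.dist_eq_sub_of_le h, if_pos (by omega)]
      exact le_mul_of_one_le_right' le_self_add
    · rw [Nat.dist_eq_sub_of_le_right h]
      rw [if_pos (show j = n - (n - j) by omega)]
      exact le_mul_of_one_le_right' le_add_self
  calc ∑' j, β ^ Nat.dist n j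
      ≤ ∑' j, ∑' i, β ^ i * ((if j = n + i then 1 else 0) + if j = n - i then 1 else 0) := by
        gcongr with j
        exact h1 j
    _ = ∑' i, β ^ i * 2 := by
        rw [ENNReal.tsum_comm]
        congr 1
        ext i
        rw [ENNReal.tsum_mul_left, ENNReal.tsum_add, tsum_ite_eq, tsum_ite_eq, one_add_one_eq_two]
    _ = _ := by rw [ENNReal.tsum_mul_right, ENNReal.tsum_geometric, mul_comm]

/-- Convolution with a geometrically decaying kernel is bounded on `ℓ^q`. -/
theorem lqNorm_tsum_pow_dist_mul_le {q : ℝ≥0∞} (h1 : 1 ≤ q) (β : ℝ≥0∞) (y : ℕ → ℝ≥0∞) :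
    lqNorm q (fun n => ∑' j, β ^ Nat.dist n j * y j) ≤ 2 * (1 - β)⁻¹ * lqNorm q y := by
  refine lqNorm_tsum_mul_le h1 (tsum_pow_dist_le β) (fun j => ?_) y
  simp_rw [Nat.dist_comm _ j]
  exact tsum_pow_dist_le β j

theorem coefficientNorm_eq_lqNorm {H : Type*} [NormedAddCommGroup H] [InnerProductSpace ℂ H]
    {K : ℕ → Type*} (Φ : ∀ j, K j → H) (α : ℝ) {q : ℝ≥0∞}
    (hq : 1 ≤ q) (f : H) : coefficientNorm Φ α q f = lqNorm q fun j =>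
      ENNReal.ofReal (2 ^ (j * α)) * (∑' k, ‖inner ℂ (Φ j k) f‖ₑ ^ 2) ^ (1 / 2 : ℝ) := by
  rcases eq_or_ne q ∞ with rfl | hqt
  · rw [lqNorm_top, coefficientNorm, if_pos rfl]
  · have hp := one_le_toReal hq hqt
    rw [lqNorm_of_ne_top hqt, coefficientNorm, if_neg hqt]
    congr 2
    ext j
    rw [ENNReal.mul_rpow_of_nonneg _ _ (by linarith), ← ENNReal.rpow_mul,
      ENNReal.ofReal_rpow_of_nonneg (by positivity) (by linarith), ← Real.rpow_mul zero_le_two,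
      one_div_mul_eq_div]

theorem le_inv_mul_of_mul_le {a x y : ℝ≥0∞} (h0 : a ≠ 0) (ht : a ≠ ∞) (h : a * x ≤ y) :
    x ≤ a⁻¹ * y := by
  calc x = a⁻¹ * (a * x) := by rw [← mul_assoc, ENNReal.inv_mul_cancel h0 ht, one_mul]
    _ ≤ _ := by gcongr

/-! ### Discretization of the interpolation norm -/

section Interpolation

variable {V : Type*} [AddCommGroup V] (nE nF : V → ℝ≥0∞)

theorem kFunctional_mono (f : V) {s t : ℝ} (h : s ≤ t) :
    kFunctional nE nF f s ≤ kFunctional nE nF f t := by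
  refine iInf₂_mono fun p _ => ?_
  gcongr

/-- The `K`-functional at `b * s` is at least `b` times its value at `s`, for `b ≤ 1`. -/
theorem mul_kFunctional_le (f : V) {b s t : ℝ} (hb0 : 0 ≤ b) (hb : b ≤ 1) (h : b * s ≤ t) :
    ENNReal.ofReal b * kFunctional nE nF f s ≤ kFunctional nE nF f t := by
  refine le_iInf₂ fun p hp => ?_
  calc ENNReal.ofReal b * kFunctional nE nF f s
      ≤ ENNReal.ofReal b * (nE p.1 + ENNReal.ofReal s * nF p.2) := by
        gcongr
        exact iInf₂_le p hp
    _ = ENNReal.ofReal b * nE p.1 + ENNReal.ofReal (b * s) * nF p.2 := by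
        rw [mul_add, ← mul_assoc, ENNReal.ofReal_mul hb0]
    _ ≤ 1 * nE p.1 + ENNReal.ofReal t * nF p.2 := by
        gcongr
        exact ENNReal.ofReal_le_one.2 hb
    _ = _ := by rw [one_mul]

theorem interpolationNorm_top (θ : ℝ) (f : V) : interpolationNorm nE nF θ ∞ f =
    ⨆ t ∈ Set.Ioi (0 : ℝ), ENNReal.ofReal (t ^ (-θ)) * kFunctional nE nF f t := if_pos rfl

theorem interpolationNorm_of_ne_top (θ : ℝ) {q : ℝ≥0∞} (hq : q ≠ ∞) (f : V) :
    interpolationNorm nE nF θ q f = (∫⁻ t in Set.Ioi (0 : ℝ),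
      (ENNReal.ofReal (t ^ (-θ)) * kFunctional nE nF f t) ^ q.toReal * ENNReal.ofReal t⁻¹) ^
        (1 / q.toReal) := if_neg hq

theorem volume_Ioc_pow_succ (b : ℝ) (n : ℕ) :
    MeasureTheory.volume (Set.Ioc (b ^ (n + 1)) (b ^ n)) = ENNReal.ofReal (b ^ n * (1 - b)) := by
  rw [Real.volume_Ioc]
  congr 1
  ring

/-- The values of the `K`-functional at the points `b ^ n` are controlled by the interpolation
norm: on `(b ^ (n + 1), b ^ n]` the `K`-functional is at least `b` times its value at `b ^ n`. -/
theorem exists_lqNorm_kFunctional_le {b θ : ℝ} (hb0 : 0 < b) (hb1 : b < 1) (hθ : 0 < θ)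
    {q : ℝ≥0∞} (h1 : 1 ≤ q) : ∃ D : ℝ≥0∞, D ≠ ∞ ∧ ∀ f,
      lqNorm q (fun n => ENNReal.ofReal ((b ^ n) ^ (-θ)) * kFunctional nE nF f (b ^ n)) ≤
        D * interpolationNorm nE nF θ q f := by
  rcases eq_or_ne q ∞ with rfl | hq
  · refine ⟨1, ENNReal.one_ne_top, fun f => ?_⟩
    rw [lqNorm_top, interpolationNorm_top, one_mul]
    exact iSup_le fun n => le_iSup₂_of_le (b ^ n) (pow_pos hb0 n) le_rfl
  have hp := one_le_toReal h1 hq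
  set p := q.toReal with hpq
  have hp0 : 0 < p := by linarith
  set e : ℝ≥0∞ := ENNReal.ofReal b * ENNReal.ofReal (1 - b) ^ (1 / p) with he
  have he0 : e ≠ 0 := by
    refine mul_ne_zero (by simpa using hb0) ?_
    simp [ENNReal.rpow_eq_zero_iff, hb1]
  have het : e ≠ ∞ := ENNReal.mul_ne_top ENNReal.ofReal_ne_top
    (ENNReal.rpow_ne_top_of_nonneg (by positivity) ENNReal.ofReal_ne_top)
  refine ⟨e⁻¹, ENNReal.inv_ne_top.2 he0, fun f => le_inv_mul_of_mul_le he0 het ?_⟩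
  rw [lqNorm_of_ne_top hq, interpolationNorm_of_ne_top _ _ _ hq, ← hpq]
  set k := kFunctional nE nF f with hk
  set w : ℕ → ℝ≥0∞ := fun n => ENNReal.ofReal ((b ^ n) ^ (-θ)) * k (b ^ n) with hw
  set G : ℝ → ℝ≥0∞ := fun t => (ENNReal.ofReal (t ^ (-θ)) * k t) ^ p * ENNReal.ofReal t⁻¹ with hG
  set I : ℕ → Set ℝ := fun n => Set.Ioc (b ^ (n + 1)) (b ^ n) with hI
  have hpow : ∀ n, 0 < b ^ n := fun n => pow_pos hb0 n
  have hpiece : ∀ n, ENNReal.ofReal b ^ p * ENNReal.ofReal (1 - b) * w n ^ p ≤ ∫⁻ t in I n, G t := by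
    intro n
    have h2 : ∀ t ∈ I n, (ENNReal.ofReal b * w n) ^ p * ENNReal.ofReal (b ^ n)⁻¹ ≤ G t := by
      intro t ht
      have ht0 : 0 < t := (hpow _).trans ht.1
      have h3 : ENNReal.ofReal b * w n ≤ ENNReal.ofReal (t ^ (-θ)) * k t := by
        have h4 : (b ^ n) ^ (-θ) ≤ t ^ (-θ) :=
          Real.rpow_le_rpow_of_nonpos ht0 ht.2 (by linarith)
        have h5 := mul_kFunctional_le nE nF f (s := b ^ n) (t := t) hb0.le hb1.le
          (by rw [← pow_succ']; exact ht.1.le)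
        calc _ = ENNReal.ofReal ((b ^ n) ^ (-θ)) * (ENNReal.ofReal b * k (b ^ n)) := by
              rw [hw]; ring
          _ ≤ _ := by gcongr
      have h6 : (b ^ n)⁻¹ ≤ t⁻¹ := inv_anti₀ ht0 ht.2
      simp only [hG]
      gcongr
    calc _ = ∫⁻ _ in I n, (ENNReal.ofReal b * w n) ^ p * ENNReal.ofReal (b ^ n)⁻¹ := by
          rw [MeasureTheory.setLIntegral_const, volume_Ioc_pow_succ,
            ENNReal.mul_rpow_of_nonneg (ENNReal.ofReal b) (w n) hp0.le,
            mul_assoc _ (ENNReal.ofReal (b ^ n)⁻¹),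
            ← ENNReal.ofReal_mul (by have := hpow n; positivity), ← mul_assoc (b ^ n)⁻¹,
            inv_mul_cancel₀ (hpow n).ne', one_mul]
          ring
      _ ≤ _ := MeasureTheory.setLIntegral_mono' measurableSet_Ioc h2
  have hsum : ENNReal.ofReal b ^ p * ENNReal.ofReal (1 - b) * ∑' n, w n ^ p ≤
      ∫⁻ t in Set.Ioi (0 : ℝ), G t := by
    have hanti : Antitone fun n : ℕ => b ^ n := pow_right_anti₀ hb0.le hb1.le
    rw [← ENNReal.tsum_mul_left]
    calc _ ≤ ∑' n, ∫⁻ t in I n, G t := ENNReal.tsum_le_tsum hpiece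
      _ = ∫⁻ t in ⋃ n, I n, G t := (MeasureTheory.lintegral_iUnion (fun _ => measurableSet_Ioc)
          hanti.pairwise_disjoint_on_Ioc_succ _).symm
      _ ≤ _ := MeasureTheory.lintegral_mono_set
          (Set.iUnion_subset fun n t ht => (hpow _).trans ht.1)
  refine le_trans (le_of_eq ?_) (ENNReal.rpow_le_rpow hsum (by positivity : 0 ≤ 1 / p))
  change e * (∑' n, w n ^ p) ^ (1 / p) = _
  rw [he, mul_assoc, mul_assoc (ENNReal.ofReal b ^ p), mul_rpow_one_div hp0,
    ENNReal.mul_rpow_of_nonneg (ENNReal.ofReal (1 - b)) _ (by positivity)]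

/-- Converse of `exists_lqNorm_kFunctional_le`, for a sequence `w` that dominates the weighted values
of the `K`-functional at the points `b ^ n`. These points only reach `t ≤ 1`; the part `t > 1` of the
interpolation norm is at most a finite multiple of the uniform bound `w 0`, as `t ^ (-θ)` decays. -/
theorem exists_interpolationNorm_le {b θ : ℝ} (hb0 : 0 < b) (hb1 : b < 1) (hθ : 0 < θ)
    {q : ℝ≥0∞} (h1 : 1 ≤ q) : ∃ D : ℝ≥0∞, D ≠ ∞ ∧ ∀ f (w : ℕ → ℝ≥0∞),
      (∀ n, ENNReal.ofReal ((b ^ n) ^ (-θ)) * kFunctional nE nF f (b ^ n) ≤ w n) →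
      (∀ t, kFunctional nE nF f t ≤ w 0) →
      interpolationNorm nE nF θ q f ≤ D * lqNorm q w := by
  have hpow : ∀ n, 0 < b ^ n := fun n => pow_pos hb0 n
  set B := ENNReal.ofReal (b ^ (-θ)) with hB
  have hB1 : 1 ≤ B := by
    rw [hB, ENNReal.one_le_ofReal]
    exact Real.one_le_rpow_of_pos_of_le_one_of_nonpos hb0 hb1.le (by linarith)
  have hlocal : ∀ f (w : ℕ → ℝ≥0∞),
      (∀ n, ENNReal.ofReal ((b ^ n) ^ (-θ)) * kFunctional nE nF f (b ^ n) ≤ w n) →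
      ∀ n, ∀ t ∈ Set.Ioc (b ^ (n + 1)) (b ^ n),
        ENNReal.ofReal (t ^ (-θ)) * kFunctional nE nF f t ≤ B * w n := by
    intro f w hw n t ht
    have h2 : t ^ (-θ) ≤ b ^ (-θ) * (b ^ n) ^ (-θ) := by
      rw [← Real.mul_rpow hb0.le (hpow n).le, ← pow_succ']
      exact Real.rpow_le_rpow_of_nonpos (hpow _) ht.1.le (by linarith)
    calc _ ≤ ENNReal.ofReal (b ^ (-θ) * (b ^ n) ^ (-θ)) * kFunctional nE nF f (b ^ n) := by
          gcongr
          exact kFunctional_mono nE nF f ht.2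
      _ = B * (ENNReal.ofReal ((b ^ n) ^ (-θ)) * kFunctional nE nF f (b ^ n)) := by
          rw [ENNReal.ofReal_mul (by positivity), mul_assoc]
      _ ≤ _ := by gcongr; exact hw n
  rcases eq_or_ne q ∞ with rfl | hq
  · refine ⟨B, ENNReal.ofReal_ne_top, fun f w hw hw0 => ?_⟩
    rw [lqNorm_top, interpolationNorm_top]
    refine iSup₂_le fun t ht => ?_
    rcases le_or_gt t 1 with ht1 | ht1
    · obtain ⟨n, hn⟩ := exists_nat_pow_near_of_lt_one ht ht1 hb0 hb1
      refine (hlocal f w hw n t hn).trans ?_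
      gcongr
      exact le_iSup w n
    · gcongr
      · exact (ENNReal.ofReal_le_one.2
          (Real.rpow_le_one_of_one_le_of_nonpos ht1.le (by linarith))).trans hB1
      · exact (hw0 t).trans (le_iSup w 0)
  have hp := one_le_toReal h1 hq
  set p := q.toReal with hpq
  have hp0 : 0 < p := by linarith
  set T := ∫⁻ t in Set.Ioi (1 : ℝ), ENNReal.ofReal (t ^ (-θ * p + -1)) with hT
  have hTtop : T ≠ ∞ := by
    have h2 : MeasureTheory.IntegrableOn (fun t : ℝ => t ^ (-θ * p + -1)) (Set.Ioi 1) :=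
      integrableOn_Ioi_rpow_of_lt (by nlinarith [mul_pos hθ hp0]) one_pos
    exact h2.lintegral_lt_top.ne
  set E := T + B ^ p * ENNReal.ofReal (b⁻¹ * (1 - b)) with hE
  have hEtop : E ≠ ∞ := ENNReal.add_ne_top.2 ⟨hTtop, ENNReal.mul_ne_top
    (ENNReal.rpow_ne_top_of_nonneg hp0.le ENNReal.ofReal_ne_top) ENNReal.ofReal_ne_top⟩
  refine ⟨E ^ (1 / p), ENNReal.rpow_ne_top_of_nonneg (by positivity) hEtop,
    fun f w hw hw0 => ?_⟩
  rw [lqNorm_of_ne_top hq, interpolationNorm_of_ne_top _ _ _ hq, ← hpq,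
    ← ENNReal.mul_rpow_of_nonneg _ _ (by positivity)]
  set k := kFunctional nE nF f with hk
  set G : ℝ → ℝ≥0∞ := fun t => (ENNReal.ofReal (t ^ (-θ)) * k t) ^ p * ENNReal.ofReal t⁻¹ with hG
  set I : ℕ → Set ℝ := fun n => Set.Ioc (b ^ (n + 1)) (b ^ n) with hI
  have hfar : ∫⁻ t in Set.Ioi (1 : ℝ), G t ≤ T * w 0 ^ p := by
    rw [hT, ← MeasureTheory.lintegral_mul_const _ (by fun_prop)]
    refine MeasureTheory.setLIntegral_mono' measurableSet_Ioi fun t ht => ?_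
    have ht0 : 0 < t := one_pos.trans ht
    rw [Real.rpow_add ht0, Real.rpow_neg_one, Real.rpow_mul ht0.le,
      ENNReal.ofReal_mul (by positivity), ← ENNReal.ofReal_rpow_of_nonneg (by positivity) hp0.le]
    calc G t ≤ (ENNReal.ofReal (t ^ (-θ)) * w 0) ^ p * ENNReal.ofReal t⁻¹ := by
          simp only [hG]
          gcongr
          exact hw0 t
      _ = _ := by
          rw [ENNReal.mul_rpow_of_nonneg _ _ hp0.le]
          ring
  have hpiece : ∀ n, ∫⁻ t in I n, G t ≤ B ^ p * ENNReal.ofReal (b⁻¹ * (1 - b)) * w n ^ p := by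
    intro n
    calc ∫⁻ t in I n, G t ≤ ∫⁻ _ in I n, (B * w n) ^ p * ENNReal.ofReal (b ^ (n + 1))⁻¹ := by
          refine MeasureTheory.setLIntegral_mono' measurableSet_Ioc fun t ht => ?_
          have h6 : t⁻¹ ≤ (b ^ (n + 1))⁻¹ := inv_anti₀ (hpow _) ht.1.le
          exact mul_le_mul' (ENNReal.rpow_le_rpow (hlocal f w hw n t ht) hp0.le)
            (ENNReal.ofReal_le_ofReal h6)
      _ = _ := by
          have h7 : (b ^ (n + 1))⁻¹ * (b ^ n * (1 - b)) = b⁻¹ * (1 - b) := by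
            have := hpow n
            rw [pow_succ]
            field_simp
          rw [MeasureTheory.setLIntegral_const, volume_Ioc_pow_succ,
            ENNReal.mul_rpow_of_nonneg _ _ hp0.le, mul_assoc _ (ENNReal.ofReal (b ^ (n + 1))⁻¹),
            ← ENNReal.ofReal_mul (by have := hpow (n + 1); positivity), h7]
          ring
  have hcover : Set.Ioi (0 : ℝ) ⊆ Set.Ioi 1 ∪ ⋃ n, I n := by
    intro t ht
    rcases le_or_gt t 1 with ht1 | ht1
    · obtain ⟨n, hn⟩ := exists_nat_pow_near_of_lt_one ht ht1 hb0 hb1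
      exact Or.inr (Set.mem_iUnion.2 ⟨n, hn⟩)
    · exact Or.inl ht1
  gcongr
  calc ∫⁻ t in Set.Ioi (0 : ℝ), G t ≤ ∫⁻ t in Set.Ioi 1 ∪ ⋃ n, I n, G t :=
        MeasureTheory.lintegral_mono_set hcover
    _ ≤ (∫⁻ t in Set.Ioi 1, G t) + ∫⁻ t in ⋃ n, I n, G t :=
        MeasureTheory.lintegral_union_le _ _ _
    _ ≤ T * w 0 ^ p + ∑' n, ∫⁻ t in I n, G t :=
        add_le_add hfar (MeasureTheory.lintegral_iUnion_le _ _)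
    _ ≤ T * (∑' n, w n ^ p) + ∑' n, B ^ p * ENNReal.ofReal (b⁻¹ * (1 - b)) * w n ^ p := by
        gcongr with n
        · exact ENNReal.le_tsum 0
        · exact hpiece n
    _ = E * ∑' n, w n ^ p := by rw [ENNReal.tsum_mul_left, hE, add_mul]

end Interpolation

/-! ### Functional calculus of `√L` on test functions -/

/-- A test function of the functional calculus `fnSqrt`: continuous on `[0, ∞)` and zero near `∞`.
Nothing is required on `(-∞, 0)`, which `fnSqrt` does not see. -/
structure IsTestFn (φ : ℝ → ℝ) : Prop where
  continuousOn : ContinuousOn φ (Set.Ici 0)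
  eq_zero : ∃ M, ∀ l, M < l → φ l = 0

theorem IsTestFn.mul_left {φ ψ : ℝ → ℝ} (hψ : IsTestFn ψ) (hφ : ContinuousOn φ (Set.Ici 0)) :
    IsTestFn fun l => φ l * ψ l := by
  obtain ⟨h, M, hM⟩ := hψ
  exact ⟨hφ.mul h, M, fun l hl => by simp [hM l hl]⟩

theorem IsTestFn.mul {φ ψ : ℝ → ℝ} (hφ : IsTestFn φ) (hψ : IsTestFn ψ) :
    IsTestFn fun l => φ l * ψ l :=
  hψ.mul_left hφ.continuousOn

theorem IsTestFn.add {φ ψ : ℝ → ℝ} (hφ : IsTestFn φ) (hψ : IsTestFn ψ) :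
    IsTestFn fun l => φ l + ψ l := by
  obtain ⟨h, M, hM⟩ := hφ
  obtain ⟨h', M', hM'⟩ := hψ
  refine ⟨h.add h', max M M', fun l hl => ?_⟩
  simp [hM l (lt_of_le_of_lt (le_max_left _ _) hl), hM' l (lt_of_le_of_lt (le_max_right _ _) hl)]

theorem IsTestFn.of_hasCompactSupport {φ : ℝ → ℝ} (h : Continuous φ) (hc : HasCompactSupport φ) :
    IsTestFn φ := by
  refine ⟨h.continuousOn, ?_⟩
  obtain ⟨M, hM⟩ := hc.isCompact.bddAbove
  refine ⟨M, fun l hl => ?_⟩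
  by_contra hne
  exact absurd (hM (subset_tsupport φ hne)) (not_le.2 hl)

theorem IsTestFn.rpow_mul {φ : ℝ → ℝ} (hφ : IsTestFn φ) {s : ℝ} (hs : 0 ≤ s) :
    IsTestFn fun l => l ^ s * φ l :=
  hφ.mul_left (Real.continuous_rpow_const hs).continuousOn

theorem IsTestFn.comp_abs {φ : ℝ → ℝ} (hφ : IsTestFn φ) :
    Continuous (fun l => φ |l|) ∧ HasCompactSupport fun l => φ |l| := by
  obtain ⟨h, M, hM⟩ := hφ
  refine ⟨h.comp_continuous continuous_abs abs_nonneg, ?_⟩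
  refine HasCompactSupport.intro (K := Set.Icc (-M) M) isCompact_Icc fun l hl => hM _ ?_
  by_contra hlt
  exact hl (abs_le.1 (not_lt.1 hlt))

/-- The continuous function of `(I + L)⁻¹` by which `fnSqrt` defines `φ(√L)`. -/
theorem IsTestFn.continuous_lift {φ : ℝ → ℝ} (hφ : IsTestFn φ) :
    Continuous fun x : ℝ => if 0 < x then φ (√(x⁻¹ - 1)) else 0 := by
  obtain ⟨h, M, hM⟩ := hφ
  rw [continuous_iff_continuousAt]
  intro x
  rcases lt_or_ge 0 x with hx | hx
  · have h1 : ContinuousAt (fun x : ℝ => φ (√(x⁻¹ - 1))) x := by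
      have h2 : ContinuousOn (fun x : ℝ => φ (√(x⁻¹ - 1))) (Set.Ioi 0) := by
        refine h.comp (ContinuousOn.sqrt ?_) fun y _ => Real.sqrt_nonneg _
        exact (continuousOn_inv₀.mono fun y hy => ne_of_gt hy).sub continuousOn_const
      exact h2.continuousAt (Ioi_mem_nhds hx)
    refine h1.congr ?_
    filter_upwards [Ioi_mem_nhds hx] with y hy
    rw [if_pos (Set.mem_Ioi.1 hy)]
  · have h1 : ∀ᶠ y in nhds x, (if 0 < y then φ (√(y⁻¹ - 1)) else 0) = 0 := by
      have hpos : (0 : ℝ) < (M ^ 2 + 1)⁻¹ := by positivity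
      filter_upwards [Iio_mem_nhds (lt_of_le_of_lt hx hpos)] with y hy
      split_ifs with hy0
      · refine hM _ (Real.lt_sqrt_of_sq_lt ?_)
        have := (lt_inv_comm₀ hy0 (by positivity)).1 hy
        linarith
      · rfl
    refine ContinuousAt.congr (continuousAt_const (y := (0 : ℝ))) ?_
    filter_upwards [h1] with y hy using hy.symm

variable {H : Type*} [NormedAddCommGroup H] [InnerProductSpace ℂ H] [CompleteSpace H]

theorem fnSqrt_congr (L : H →ₗ.[ℂ] H) {φ ψ : ℝ → ℝ} (h : ∀ l, 0 ≤ l → φ l = ψ l) :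
    fnSqrt L φ = fnSqrt L ψ := by
  rw [fnSqrt, fnSqrt]
  congr 1
  ext x
  rw [h _ (Real.sqrt_nonneg _)]

theorem fnSqrt_eq_zero (L : H →ₗ.[ℂ] H) {φ : ℝ → ℝ} (h : ∀ l, 0 ≤ l → φ l = 0) :
    fnSqrt L φ = 0 := by
  rw [fnSqrt_congr L (ψ := fun _ => 0) h, fnSqrt]
  simp only [ite_self]
  exact cfc_const_zero ℝ _

theorem fnSqrt_mul (L : H →ₗ.[ℂ] H) {φ ψ : ℝ → ℝ} (hφ : IsTestFn φ) (hψ : IsTestFn ψ) :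
    fnSqrt L (fun l => φ l * ψ l) = fnSqrt L φ * fnSqrt L ψ := by
  rw [fnSqrt, fnSqrt, fnSqrt, ← cfc_mul _ _ _ hφ.continuous_lift.continuousOn
    hψ.continuous_lift.continuousOn]
  congr 1
  ext x
  split_ifs <;> simp

theorem fnSqrt_add (L : H →ₗ.[ℂ] H) {φ ψ : ℝ → ℝ} (hφ : IsTestFn φ) (hψ : IsTestFn ψ) :
    fnSqrt L (fun l => φ l + ψ l) = fnSqrt L φ + fnSqrt L ψ := by
  rw [fnSqrt, fnSqrt, fnSqrt, ← cfc_add _ _ _ hφ.continuous_lift.continuousOn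
    hψ.continuous_lift.continuousOn]
  congr 1
  ext x
  split_ifs <;> simp

theorem norm_fnSqrt_apply_le (L : H →ₗ.[ℂ] H) {φ : ℝ → ℝ} {B : ℝ} (hB : 0 ≤ B)
    (h : ∀ l, 0 ≤ l → |φ l| ≤ B) (f : H) : ‖fnSqrt L φ f‖ ≤ B * ‖f‖ := by
  refine (fnSqrt L φ).le_of_opNorm_le (norm_cfc_le hB fun x _ => ?_) f
  split_ifs
  · exact h _ (Real.sqrt_nonneg _)
  · simpa using hB

theorem enorm_fnSqrt_apply_le (L : H →ₗ.[ℂ] H) {φ : ℝ → ℝ} {B : ℝ} (hB : 0 ≤ B)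
    (h : ∀ l, 0 ≤ l → |φ l| ≤ B) (f : H) : ‖fnSqrt L φ f‖ₑ ≤ ENNReal.ofReal B * ‖f‖ₑ := by
  rw [← ofReal_norm, ← ofReal_norm, ← ENNReal.ofReal_mul hB]
  exact ENNReal.ofReal_le_ofReal (norm_fnSqrt_apply_le L hB h f)

theorem inner_fnSqrt_left (L : H →ₗ.[ℂ] H) (φ : ℝ → ℝ) (u v : H) :
    inner ℂ (fnSqrt L φ u) v = inner ℂ u (fnSqrt L φ v) := by
  have h : IsSelfAdjoint (fnSqrt L φ) := cfc_predicate _ _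
  exact h.isSymmetric u v

theorem isPositive_resolvent {L : H →ₗ.[ℂ] H} (hL : IsNonnegSelfAdjoint L) :
    (resolvent L).IsPositive := by
  have hR := isResolvent_resolvent hL
  have hsym : ∀ x y : L.domain, inner ℂ (L x) (y : H) = inner ℂ (x : H) (L y) := by
    have h := LinearPMap.adjoint_isFormalAdjoint hL.isSelfAdjoint.dense_domain
    have hsa : L.adjoint = L := hL.isSelfAdjoint
    rw [hsa] at h
    exact fun x y => h x y
  refine ⟨fun f₁ f₂ => ?_, fun f => ?_⟩
  · obtain ⟨h1, e1⟩ := hR f₁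
    obtain ⟨h2, e2⟩ := hR f₂
    change inner ℂ (resolvent L f₁) f₂ = inner ℂ f₁ (resolvent L f₂)
    conv_lhs => rw [← e2]
    conv_rhs => rw [← e1]
    rw [inner_add_left, inner_add_right, hsym ⟨_, h1⟩ ⟨_, h2⟩]
  · obtain ⟨h1, e1⟩ := hR f
    change 0 ≤ (inner ℂ (resolvent L f) f).re
    have h4 : inner ℂ (resolvent L f) f =
        inner ℂ (resolvent L f) (resolvent L f + L ⟨_, h1⟩) := by rw [e1]
    rw [h4, inner_add_right, Complex.add_re, ← hsym ⟨_, h1⟩ ⟨_, h1⟩]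
    have h2 := hL.nonneg ⟨_, h1⟩
    have h3 : 0 ≤ (inner ℂ (resolvent L f) (resolvent L f)).re := by
      exact inner_self_nonneg (𝕜 := ℂ)
    exact add_nonneg h3 h2

theorem dense_range_resolvent {L : H →ₗ.[ℂ] H} (hL : IsNonnegSelfAdjoint L) :
    DenseRange (resolvent L) := by
  have hsa : ContinuousLinearMap.adjoint (resolvent L) = resolvent L :=
    (isPositive_resolvent hL).isSelfAdjoint
  have h : Dense (((resolvent L : H →ₗ[ℂ] H).range : Submodule ℂ H) : Set H) := by
    rw [Submodule.dense_iff_topologicalClosure_eq_top, Submodule.topologicalClosure_eq_top_iff,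
      ContinuousLinearMap.orthogonal_range, hsa, Submodule.eq_bot_iff]
    intro f hf
    have hf0 : resolvent L f = 0 := hf
    obtain ⟨h1, e1⟩ := isResolvent_resolvent hL f
    have h2 : (⟨resolvent L f, h1⟩ : L.domain) = 0 := Subtype.ext hf0
    rw [h2, LinearPMap.map_zero, hf0, add_zero] at e1
    exact e1.symm
  exact h

/-- On the range of the resolvent, a spectral cutoff at height `ω` is close to the identity at a
quantitative rate, as `x = 1 / (1 + λ²)` is small where the cutoff differs from `1`. -/
theorem norm_resolvent_sub_fnSqrt_le {L : H →ₗ.[ℂ] H} (hL : IsNonnegSelfAdjoint L) {φ : ℝ → ℝ}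
    (hφ : IsTestFn φ) (h01 : ∀ l, 0 ≤ l → φ l ∈ Set.Icc (0 : ℝ) 1) {ω : ℝ} (hω : 0 ≤ ω)
    (h1 : ∀ l ∈ Set.Icc 0 ω, φ l = 1) (u : H) :
    ‖resolvent L u - fnSqrt L φ (resolvent L u)‖ ≤ (1 + ω ^ 2)⁻¹ * ‖u‖ := by
  have hpos := isPositive_resolvent hL
  have hsa : IsSelfAdjoint (resolvent L) := hpos.isSelfAdjoint
  have hcont := hφ.continuous_lift
  have hc2 : Continuous fun x : ℝ => (if 0 < x then φ (√(x⁻¹ - 1)) else 0) * x :=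
    hcont.mul continuous_id
  have key : resolvent L - fnSqrt L φ * resolvent L =
      cfc (fun x : ℝ => x - (if 0 < x then φ (√(x⁻¹ - 1)) else 0) * x) (resolvent L) := by
    rw [cfc_sub (fun x : ℝ => x) _ _ continuousOn_id hc2.continuousOn,
      cfc_mul _ (fun x : ℝ => x) _ hcont.continuousOn continuousOn_id, cfc_id' ℝ (resolvent L)]
    rfl
  have happ : resolvent L u - fnSqrt L φ (resolvent L u) =
      (resolvent L - fnSqrt L φ * resolvent L) u := rfl
  rw [happ, key]
  refine ContinuousLinearMap.le_of_opNorm_le _ (norm_cfc_le (by positivity) fun x hx => ?_) u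
  have hx0 : 0 ≤ x := spectrum_nonneg_of_nonneg
    ((ContinuousLinearMap.nonneg_iff_isPositive _).2 hpos) hx
  rcases hx0.eq_or_lt with rfl | hx0
  · simp; positivity
  rw [if_pos hx0]
  set l := √(x⁻¹ - 1) with hl
  have hl0 : 0 ≤ l := Real.sqrt_nonneg _
  rcases le_or_gt l ω with hlω | hlω
  · rw [h1 l ⟨hl0, hlω⟩]; simp; positivity
  · have h2 : ω ^ 2 < x⁻¹ - 1 := (Real.lt_sqrt hω).1 hlω
    have h3 : x ≤ (1 + ω ^ 2)⁻¹ := by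
      rw [le_inv_comm₀ hx0 (by positivity)]
      linarith
    obtain ⟨h4, h5⟩ := h01 l hl0
    rw [Real.norm_eq_abs, abs_le]
    constructor <;> nlinarith

/-- Spectral cutoffs at increasing heights converge strongly to the identity. -/
theorem tendsto_fnSqrt_cutoff {L : H →ₗ.[ℂ] H} (hL : IsNonnegSelfAdjoint L) {φ : ℕ → ℝ → ℝ}
    (hφ : ∀ n, IsTestFn (φ n)) (h01 : ∀ n l, 0 ≤ l → φ n l ∈ Set.Icc (0 : ℝ) 1)
    (h1 : ∀ n, ∀ l ∈ Set.Icc (0 : ℝ) (2 ^ n), φ n l = 1) (f : H) :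
    Filter.Tendsto (fun n => fnSqrt L (φ n) f) Filter.atTop (nhds f) := by
  have hcontr : ∀ n v, ‖fnSqrt L (φ n) v‖ ≤ ‖v‖ := fun n v => by
    have := norm_fnSqrt_apply_le L zero_le_one
      (fun l hl => abs_le.2 ⟨by linarith [(h01 n l hl).1], (h01 n l hl).2⟩) v
    simpa using this
  rw [Metric.tendsto_atTop]
  intro ε hε
  obtain ⟨u, hu⟩ := (dense_range_resolvent hL).exists_dist_lt f (show 0 < ε / 3 by positivity)
  have hlim : Filter.Tendsto (fun n : ℕ => ((1 : ℝ) / 2) ^ n * ‖u‖) Filter.atTop (nhds 0) := by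
    simpa using (tendsto_pow_atTop_nhds_zero_of_lt_one (r := (1 : ℝ) / 2) (by norm_num)
      (by norm_num)).mul_const ‖u‖
  obtain ⟨N, hN⟩ := Metric.tendsto_atTop.1 hlim (ε / 3) (by positivity)
  refine ⟨N, fun n hn => ?_⟩
  have h2 := norm_resolvent_sub_fnSqrt_le hL (hφ n) (h01 n) (by positivity) (h1 n) u
  have h3 : (1 + ((2 : ℝ) ^ n) ^ 2)⁻¹ ≤ (1 / 2) ^ n := by
    rw [one_div, inv_pow]
    refine inv_anti₀ (by positivity) ?_
    nlinarith [sq_nonneg ((2 : ℝ) ^ n - 1)]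
  have h4 := hN n hn
  rw [Real.dist_eq, sub_zero, abs_of_nonneg (by positivity)] at h4
  have h5 := hcontr n (resolvent L u - f)
  rw [dist_eq_norm] at hu ⊢
  have h6 : fnSqrt L (φ n) f - f = -(resolvent L u - fnSqrt L (φ n) (resolvent L u)) -
      fnSqrt L (φ n) (resolvent L u - f) - (f - resolvent L u) := by
    rw [map_sub]; abel
  rw [h6]
  have h7 := mul_le_mul_of_nonneg_right h3 (norm_nonneg u)
  rw [norm_sub_rev] at h5
  calc _ ≤ ‖resolvent L u - fnSqrt L (φ n) (resolvent L u)‖ +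
        ‖fnSqrt L (φ n) (resolvent L u - f)‖ + ‖f - resolvent L u‖ := by
        refine (norm_sub_le _ _).trans (add_le_add_left ((norm_sub_le _ _).trans ?_) _)
        rw [norm_neg]
    _ < ε := by
        have := norm_sub_rev f (resolvent L u)
        linarith [hcontr n (resolvent L u - f)]

/-- A continuous cutoff that is `1` on `[0, ω]` and `0` beyond `ω + 1`. -/
def ramp (ω l : ℝ) : ℝ := max 0 (min 1 (ω + 1 - l))

theorem isTestFn_ramp (ω : ℝ) : IsTestFn (ramp ω) := by
  refine ⟨by unfold ramp; fun_prop, ω + 1, fun l hl => ?_⟩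
  exact max_eq_left ((min_le_right _ _).trans (by linarith))

theorem ramp_mem_Icc (ω l : ℝ) : ramp ω l ∈ Set.Icc (0 : ℝ) 1 :=
  ⟨le_max_left _ _, max_le zero_le_one (min_le_left _ _)⟩

theorem ramp_eq_one {ω l : ℝ} (h : l ≤ ω) : ramp ω l = 1 := by
  rw [ramp, min_eq_left (by linarith), max_eq_right zero_le_one]

/-! ### Powers of `√L` -/

/-- The test functions in the definition of the graph are continuous on `ℝ`. Those that are only
controlled on `[0, ∞)` reduce to them by passing to `φ |l|`. -/
theorem mem_sqrtPowGraph_iff {L : H →ₗ.[ℂ] H} {s : ℝ} {p : H × H} :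
    p ∈ sqrtPowGraph L s ↔
      ∀ φ : ℝ → ℝ, IsTestFn φ → fnSqrt L φ p.2 = fnSqrt L (fun l => l ^ s * φ l) p.1 := by
  refine ⟨fun h φ hφ => ?_, fun h φ h1 h2 => h φ (.of_hasCompactSupport h1 h2)⟩
  have := h _ hφ.comp_abs.1 hφ.comp_abs.2
  rwa [fnSqrt_congr L (φ := fun l => φ |l|) (ψ := φ) fun l hl => by rw [abs_of_nonneg hl],
    fnSqrt_congr L (φ := fun l => l ^ s * φ |l|) (ψ := fun l => l ^ s * φ l) fun l hl => by
      rw [abs_of_nonneg hl]] at this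

/-- The graph of a power of `√L` is single-valued, so `sqrtPow` does not take the junk value of
`Submodule.toLinearPMap`. -/
theorem snd_eq_zero_of_mem_sqrtPowGraph {L : H →ₗ.[ℂ] H} (hL : IsNonnegSelfAdjoint L) (s : ℝ) :
    ∀ p ∈ sqrtPowGraph L s, p.1 = 0 → p.2 = 0 := by
  intro p hp h0
  have h1 : ∀ n : ℕ, fnSqrt L (ramp (2 ^ n)) p.2 = 0 := fun n => by
    rw [mem_sqrtPowGraph_iff.1 hp _ (isTestFn_ramp _), h0, map_zero]
  have h2 := tendsto_fnSqrt_cutoff hL (fun n => isTestFn_ramp (2 ^ n))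
    (fun n l _ => ramp_mem_Icc _ l) (fun n l hl => ramp_eq_one hl.2) p.2
  simp only [h1] at h2
  exact tendsto_nhds_unique h2 tendsto_const_nhds

theorem mem_domain_sqrtPow {L : H →ₗ.[ℂ] H} {s : ℝ} {f h : H} (hp : (f, h) ∈ sqrtPowGraph L s) :
    f ∈ (sqrtPow L s).domain :=
  ⟨(f, h), hp, rfl⟩

theorem sqrtPow_apply {L : H →ₗ.[ℂ] H} (hL : IsNonnegSelfAdjoint L) {s : ℝ} {f h : H}
    (hp : (f, h) ∈ sqrtPowGraph L s) (hf : f ∈ (sqrtPow L s).domain) :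
    sqrtPow L s ⟨f, hf⟩ = h := by
  have h1 := Submodule.mem_graph_toLinearPMap (snd_eq_zero_of_mem_sqrtPowGraph hL s) ⟨f, hf⟩
  have h2 := snd_eq_zero_of_mem_sqrtPowGraph hL s _ (Submodule.sub_mem _ h1 hp) (sub_self f)
  exact sub_eq_zero.1 h2

theorem mem_sqrtPowGraph_apply {L : H →ₗ.[ℂ] H} (hL : IsNonnegSelfAdjoint L) {s : ℝ} {f : H}
    (hf : f ∈ (sqrtPow L s).domain) : (f, sqrtPow L s ⟨f, hf⟩) ∈ sqrtPowGraph L s :=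
  Submodule.mem_graph_toLinearPMap (snd_eq_zero_of_mem_sqrtPowGraph hL s) ⟨f, hf⟩

/-- Vectors of bounded spectrum lie in the domain of every power of `√L`. -/
theorem fnSqrt_mem_sqrtPowGraph (L : H →ₗ.[ℂ] H) {φ : ℝ → ℝ} (hφ : IsTestFn φ) {s : ℝ}
    (hs : 0 ≤ s) (f : H) :
    (fnSqrt L φ f, fnSqrt L (fun l => l ^ s * φ l) f) ∈ sqrtPowGraph L s := by
  refine mem_sqrtPowGraph_iff.2 fun ψ hψ => ?_
  change fnSqrt L ψ (fnSqrt L (fun l => l ^ s * φ l) f) =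
    fnSqrt L (fun l => l ^ s * ψ l) (fnSqrt L φ f)
  rw [← mul_apply_eq_comp, ← mul_apply_eq_comp,
    ← fnSqrt_mul L hψ (hφ.rpow_mul hs), ← fnSqrt_mul L (hψ.rpow_mul hs) hφ]
  congr 2
  ext l
  ring

/-- Bernstein inequality with its sharp constant `ω ^ s`. -/
theorem norm_fnSqrt_rpow_mul_le (L : H →ₗ.[ℂ] H) {φ : ℝ → ℝ} (hφ : IsTestFn φ) {s ω : ℝ}
    (hs : 0 ≤ s) (hω : 0 ≤ ω) (h0 : ∀ l, ω ≤ l → φ l = 0) (f : H) :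
    ‖fnSqrt L (fun l => l ^ s * φ l) f‖ ≤ ω ^ s * ‖fnSqrt L φ f‖ := by
  -- Truncating `l ^ s` at `ω` does not change its product with `φ`.
  have hψ : IsTestFn fun l => min l ω ^ s * ramp ω l :=
    (isTestFn_ramp ω).mul_left
      (((Real.continuous_rpow_const hs).comp (continuous_id.min continuous_const)).continuousOn)
  have key : fnSqrt L (fun l => l ^ s * φ l) =
      fnSqrt L (fun l => min l ω ^ s * ramp ω l) * fnSqrt L φ := by
    rw [← fnSqrt_mul L hψ hφ]
    refine fnSqrt_congr L fun l _ => ?_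
    rcases le_total ω l with h | h
    · simp [h0 l h]
    · rw [min_eq_left h, ramp_eq_one h, mul_one]
  rw [key]
  refine norm_fnSqrt_apply_le L (by positivity) (fun l hl => ?_) _
  have h1 : 0 ≤ min l ω := le_min hl hω
  obtain ⟨h2, h3⟩ := ramp_mem_Icc ω l
  rw [abs_of_nonneg (by positivity)]
  exact (mul_le_of_le_one_right (by positivity) h3).trans
    (Real.rpow_le_rpow h1 (min_le_right _ _) hs)

/-- Estimate of a high-frequency part by a power of `√L`. -/
theorem norm_fnSqrt_le_of_eq_zero (L : H →ₗ.[ℂ] H) {φ : ℝ → ℝ} (hφ : IsTestFn φ)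
    (h1 : ∀ l, 0 ≤ l → |φ l| ≤ 1) {s ω : ℝ} (hs : 0 ≤ s) (hω : 0 < ω)
    (h0 : ∀ l, 0 ≤ l → l ≤ ω → φ l = 0) {f h : H} (hp : (f, h) ∈ sqrtPowGraph L s) :
    ‖fnSqrt L φ f‖ ≤ ω ^ (-s) * ‖h‖ := by
  -- The quotient `φ(l) / l ^ s` is a test function, as `φ` vanishes on `[0, ω]`.
  have hpos : ∀ l : ℝ, 0 < max l ω := fun l => lt_max_of_lt_right hω
  have hψ : IsTestFn fun l => max l ω ^ (-s) * φ l := by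
    refine hφ.mul_left (Continuous.continuousOn ?_)
    exact (continuous_id.max continuous_const).rpow_const fun l => Or.inl (hpos l).ne'
  have h2 := mem_sqrtPowGraph_iff.1 hp _ hψ
  rw [fnSqrt_congr L (φ := fun l => l ^ s * (max l ω ^ (-s) * φ l)) (ψ := φ) fun l hl => ?_] at h2
  · change fnSqrt L _ h = fnSqrt L φ f at h2
    rw [← h2]
    refine norm_fnSqrt_apply_le L (by positivity) (fun l hl => ?_) _
    rw [abs_mul, abs_of_nonneg (Real.rpow_nonneg (hpos l).le _)]
    refine (mul_le_of_le_one_right (Real.rpow_nonneg (hpos l).le _) (h1 l hl)).trans ?_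
    exact Real.rpow_le_rpow_of_nonpos hω (le_max_right _ _) (by linarith)
  · rcases le_total l ω with h | h
    · simp [h0 l hl h]
    · have : 0 < l := hω.trans_le h
      rw [max_eq_left h, ← mul_assoc, ← Real.rpow_add this]
      simp

/-- Vectors `φ(√L) f`, with `φ` vanishing beyond `ω`, are Paley-Wiener vectors. -/
theorem fnSqrt_mem_paleyWiener (L : H →ₗ.[ℂ] H) {φ : ℝ → ℝ} (hφ : IsTestFn φ) {ω : ℝ}
    (h0 : ∀ l, ω ≤ l → φ l = 0) (f : H) : fnSqrt L φ f ∈ paleyWiener L ω := by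
  intro ψ h1 h2 h3
  rw [← mul_apply_eq_comp, ← fnSqrt_mul L (.of_hasCompactSupport h1 h2) hφ,
    fnSqrt_eq_zero L fun l hl => ?_, zero_apply]
  rcases le_total l ω with h | h
  · simp [h3 l ⟨hl, h⟩]
  · simp [h0 l h]

/-! ### The dyadic partition of unity -/

theorem IsCutoff.eq_zero_of_two_le {g : ℝ → ℝ} (hg : IsCutoff g) {l : ℝ} (hl : 2 ≤ l) :
    g l = 0 := by
  rcases hl.eq_or_lt with rfl | hl
  · -- At the endpoint `2` itself, `g` vanishes by continuity from the right.
    have h1 : Filter.Tendsto g (nhdsWithin 2 (Set.Ioi 2)) (nhds (g 2)) :=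
      (hg.contDiffOn.continuousOn 2 (by simp)).mono fun x hx => by
        have : (2 : ℝ) < x := hx
        exact Set.mem_Ici.2 (by linarith)
    refine tendsto_nhds_unique (h1.congr' ?_) tendsto_const_nhds
    filter_upwards [self_mem_nhdsWithin] with x hx using hg.eq_zero x hx
  · exact hg.eq_zero l hl

theorem isTestFn_cutoff {g : ℝ → ℝ} (hg : IsCutoff g) {a : ℝ} (ha : 0 < a) :
    IsTestFn fun l => g (l / a) := by
  refine ⟨hg.contDiffOn.continuousOn.comp (by fun_prop) fun l hl => ?_, 2 * a, fun l hl => ?_⟩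
  · exact Set.mem_Ici.2 (div_nonneg hl ha.le)
  · exact hg.eq_zero _ ((lt_div_iff₀ ha).2 hl)

theorem quadPartition_zero (g : ℝ → ℝ) (l : ℝ) : quadPartition g 0 l = √(g l) := if_pos rfl

theorem quadPartition_succ (g : ℝ → ℝ) (j : ℕ) (l : ℝ) :
    quadPartition g (j + 1) l = √(g (l / 2 ^ (j + 1)) - g (l / 2 ^ j)) := by
  rw [quadPartition, if_neg (Nat.succ_ne_zero j)]
  congr 3
  rw [pow_succ]
  ring_nf

theorem quadPartition_eq_zero_of_le {g : ℝ → ℝ} (hg : IsCutoff g) {j : ℕ} {l : ℝ}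
    (hl : 2 ^ (j + 1) ≤ l) : quadPartition g j l = 0 := by
  cases j with
  | zero =>
    rw [quadPartition_zero, hg.eq_zero_of_two_le (by simpa using hl), Real.sqrt_zero]
  | succ j =>
    have h1 : (2 : ℝ) * 2 ^ (j + 1) ≤ l := by rwa [← pow_succ']
    have h2 : (2 : ℝ) * 2 ^ j ≤ l := by
      refine le_trans ?_ h1
      gcongr
      · norm_num
      · omega
    rw [quadPartition_succ, hg.eq_zero_of_two_le ((le_div_iff₀ (by positivity)).2 h1),
      hg.eq_zero_of_two_le ((le_div_iff₀ (by positivity)).2 h2), sub_zero, Real.sqrt_zero]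

theorem quadPartition_succ_eq_zero {g : ℝ → ℝ} (hg : IsCutoff g) {j : ℕ} {l : ℝ}
    (h0 : 0 ≤ l) (hl : l ≤ 2 ^ j) : quadPartition g (j + 1) l = 0 := by
  have h1 : l ≤ 2 ^ (j + 1) := hl.trans (pow_le_pow_right₀ (by norm_num) (Nat.le_succ j))
  rw [quadPartition_succ, hg.eq_one _ ⟨by positivity, (div_le_one₀ (by positivity)).2 h1⟩,
    hg.eq_one _ ⟨by positivity, (div_le_one₀ (by positivity)).2 hl⟩, sub_self, Real.sqrt_zero]

theorem isTestFn_quadPartition {g : ℝ → ℝ} (hg : IsCutoff g) (j : ℕ) :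
    IsTestFn (quadPartition g j) := by
  refine ⟨?_, 2 ^ (j + 1), fun l hl => quadPartition_eq_zero_of_le hg hl.le⟩
  cases j with
  | zero =>
    simp only [funext (quadPartition_zero g)]
    exact hg.contDiffOn.continuousOn.sqrt
  | succ j =>
    simp only [funext (quadPartition_succ g j)]
    exact ((isTestFn_cutoff hg (by positivity)).continuousOn.sub
      (isTestFn_cutoff hg (by positivity)).continuousOn).sqrt

theorem abs_quadPartition_le_one {g : ℝ → ℝ} (hg : IsCutoff g) (j : ℕ) {l : ℝ} (hl : 0 ≤ l) :
    |quadPartition g j l| ≤ 1 := by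
  cases j with
  | zero =>
    rw [quadPartition_zero, abs_of_nonneg (Real.sqrt_nonneg _)]
    exact Real.sqrt_le_one.2 (hg.mem_Icc l hl).2
  | succ j =>
    rw [quadPartition_succ, abs_of_nonneg (Real.sqrt_nonneg _), Real.sqrt_le_one]
    linarith [(hg.mem_Icc (l / 2 ^ (j + 1)) (by positivity)).2,
      (hg.mem_Icc (l / 2 ^ j) (by positivity)).1]

theorem quadPartition_succ_mul_self {g : ℝ → ℝ} (hg : IsCutoff g) (j : ℕ) {l : ℝ} (hl : 0 ≤ l) :
    quadPartition g (j + 1) l * quadPartition g (j + 1) l =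
      g (l / 2 ^ (j + 1)) - g (l / 2 ^ j) := by
  rw [quadPartition_succ, Real.mul_self_sqrt]
  refine sub_nonneg.2 (hg.antitoneOn (Set.mem_Ici.2 (by positivity)) (Set.mem_Ici.2 (by positivity))
    ?_)
  gcongr
  · norm_num
  · omega

/-- The dyadic spectral piece `F_j(√L)`. -/
noncomputable def dyadicPart (L : H →ₗ.[ℂ] H) (g : ℝ → ℝ) (j : ℕ) : H →L[ℂ] H :=
  fnSqrt L (quadPartition g j)

theorem enorm_dyadicPart_le (L : H →ₗ.[ℂ] H) {g : ℝ → ℝ} (hg : IsCutoff g) (j : ℕ) (f : H) :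
    ‖dyadicPart L g j f‖ₑ ≤ ‖f‖ₑ := by
  have h := enorm_fnSqrt_apply_le L zero_le_one (fun l hl => abs_quadPartition_le_one hg j hl) f
  rwa [ENNReal.ofReal_one, one_mul] at h

/-- The squares of the partition functions telescope to the cutoff `g(2⁻ᴺ λ)`. -/
theorem sum_dyadicPart_dyadicPart (L : H →ₗ.[ℂ] H) {g : ℝ → ℝ} (hg : IsCutoff g) (N : ℕ) (f : H) :
    ∑ j ∈ Finset.range (N + 1), dyadicPart L g j (dyadicPart L g j f) =
      fnSqrt L (fun l => g (l / 2 ^ N)) f := by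
  induction N with
  | zero =>
    rw [Finset.sum_range_one, dyadicPart, ← mul_apply_eq_comp,
      ← fnSqrt_mul L (isTestFn_quadPartition hg 0) (isTestFn_quadPartition hg 0)]
    congr 1
    refine fnSqrt_congr L fun l hl => ?_
    rw [quadPartition_zero, Real.mul_self_sqrt (hg.mem_Icc l hl).1, pow_zero, div_one]
  | succ N ih =>
    have hF := isTestFn_quadPartition hg (N + 1)
    rw [Finset.sum_range_succ, ih, dyadicPart, ← mul_apply_eq_comp, ← fnSqrt_mul L hF hF,
      ← add_apply, ← fnSqrt_add L (isTestFn_cutoff hg (by positivity)) (hF.mul hF)]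
    congr 1
    refine fnSqrt_congr L fun l hl => ?_
    rw [quadPartition_succ_mul_self hg N hl]
    ring

/-- Calderón reproducing formula `f = ∑ F_j(√L)² f`. -/
theorem tendsto_sum_dyadicPart {L : H →ₗ.[ℂ] H} (hL : IsNonnegSelfAdjoint L) {g : ℝ → ℝ}
    (hg : IsCutoff g) (f : H) :
    Filter.Tendsto (fun N => ∑ j ∈ Finset.range N, dyadicPart L g j (dyadicPart L g j f))
      Filter.atTop (nhds f) := by
  rw [← Filter.tendsto_add_atTop_iff_nat 1]
  simp only [sum_dyadicPart_dyadicPart L hg]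
  refine tendsto_fnSqrt_cutoff hL (fun n => isTestFn_cutoff hg (by positivity))
    (fun n l hl => hg.mem_Icc _ (by positivity)) (fun n l hl => hg.eq_one _ ⟨?_, ?_⟩) f
  · exact div_nonneg hl.1 (by positivity)
  · exact (div_le_one₀ (by positivity)).2 hl.2

theorem enorm_sub_sum_dyadicPart_le {L : H →ₗ.[ℂ] H} (hL : IsNonnegSelfAdjoint L) {g : ℝ → ℝ}
    (hg : IsCutoff g) (n : ℕ) (f : H) :
    ‖f - ∑ j ∈ Finset.range n, dyadicPart L g j (dyadicPart L g j f)‖ₑ ≤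
      ∑' i, ‖dyadicPart L g (i + n) f‖ₑ := by
  set u : ℕ → H := fun j => dyadicPart L g j (dyadicPart L g j f) with hu
  have h1 : Filter.Tendsto (fun N => ∑ i ∈ Finset.range N, u (n + i)) Filter.atTop
      (nhds (f - ∑ j ∈ Finset.range n, u j)) := by
    have h2 := ((Filter.tendsto_add_atTop_iff_nat n).2 (tendsto_sum_dyadicPart hL hg f)).sub_const
      (∑ j ∈ Finset.range n, u j)
    refine h2.congr fun N => ?_
    rw [add_comm N n, Finset.sum_range_add, add_sub_cancel_left]
  refine le_of_tendsto h1.enorm (Filter.Eventually.of_forall fun N => ?_)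
  calc ‖∑ i ∈ Finset.range N, u (n + i)‖ₑ ≤ ∑ i ∈ Finset.range N, ‖u (n + i)‖ₑ :=
        enorm_sum_le _ _
    _ ≤ ∑ i ∈ Finset.range N, ‖dyadicPart L g (i + n) f‖ₑ := by
        refine Finset.sum_le_sum fun i _ => ?_
        rw [add_comm i n]
        exact enorm_dyadicPart_le L hg _ _
    _ ≤ _ := ENNReal.sum_le_tsum _

/-! ### Dyadic pieces and the `K`-functional -/

theorem sobolevNorm_eq {L : H →ₗ.[ℂ] H} (hL : IsNonnegSelfAdjoint L) {s : ℝ} {f h : H}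
    (hp : (f, h) ∈ sqrtPowGraph L s) : sobolevNorm L s f = ‖f‖ₑ + ‖h‖ₑ := by
  rw [sobolevNorm, dif_pos (mem_domain_sqrtPow hp), sqrtPow_apply hL hp]

theorem sobolevNorm_zero {L : H →ₗ.[ℂ] H} (hL : IsNonnegSelfAdjoint L) (s : ℝ) :
    sobolevNorm L s 0 = 0 := by
  rw [sobolevNorm_eq hL (Submodule.zero_mem (sqrtPowGraph L s))]
  simp

theorem sobolevNorm_add_le {L : H →ₗ.[ℂ] H} (hL : IsNonnegSelfAdjoint L) (s : ℝ) (u v : H) :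
    sobolevNorm L s (u + v) ≤ sobolevNorm L s u + sobolevNorm L s v := by
  by_cases hu : u ∈ (sqrtPow L s).domain
  swap
  · conv_rhs => rw [sobolevNorm, dif_neg hu, top_add]
    exact le_top
  by_cases hv : v ∈ (sqrtPow L s).domain
  swap
  · conv_rhs => rw [sobolevNorm.eq_def L s v, dif_neg hv, add_top]
    exact le_top
  have h1 := mem_sqrtPowGraph_apply hL hu
  have h2 := mem_sqrtPowGraph_apply hL hv
  rw [sobolevNorm_eq hL h1, sobolevNorm_eq hL h2, sobolevNorm_eq hL (Submodule.add_mem _ h1 h2)]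
  calc _ ≤ (‖u‖ₑ + ‖v‖ₑ) + (‖sqrtPow L s ⟨u, hu⟩‖ₑ + ‖sqrtPow L s ⟨v, hv⟩‖ₑ) :=
        add_le_add (enorm_add_le _ _) (enorm_add_le _ _)
    _ = _ := add_add_add_comm _ _ _ _

theorem sobolevNorm_dyadicPart_le {L : H →ₗ.[ℂ] H} (hL : IsNonnegSelfAdjoint L) {g : ℝ → ℝ}
    (hg : IsCutoff g) {s : ℝ} (hs : 0 ≤ s) (j : ℕ) (f : H) :
    sobolevNorm L s (dyadicPart L g j f) ≤
      ENNReal.ofReal (1 + ((2 : ℝ) ^ (j + 1)) ^ s) * ‖dyadicPart L g j f‖ₑ := by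
  have hF := isTestFn_quadPartition hg j
  rw [dyadicPart, sobolevNorm_eq hL (fnSqrt_mem_sqrtPowGraph L hF hs f),
    ENNReal.ofReal_add zero_le_one (by positivity), add_mul, ENNReal.ofReal_one, one_mul]
  gcongr
  rw [← ofReal_norm, ← ofReal_norm, ← ENNReal.ofReal_mul (by positivity)]
  exact ENNReal.ofReal_le_ofReal (norm_fnSqrt_rpow_mul_le L hF hs (by positivity)
    (fun l hl => quadPartition_eq_zero_of_le hg hl) f)

theorem enorm_dyadicPart_le_sobolevNorm {L : H →ₗ.[ℂ] H} (hL : IsNonnegSelfAdjoint L) {g : ℝ → ℝ}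
    (hg : IsCutoff g) {s : ℝ} (hs : 0 ≤ s) (j : ℕ) (f : H) :
    ‖dyadicPart L g j f‖ₑ ≤
      ENNReal.ofReal (2 ^ s) * (ENNReal.ofReal (((2 : ℝ) ^ (-s)) ^ j) * sobolevNorm L s f) := by
  by_cases hf : f ∈ (sqrtPow L s).domain
  swap
  · rw [sobolevNorm, dif_neg hf, ENNReal.mul_top (by simp; positivity),
      ENNReal.mul_top (by simp; positivity)]
    exact le_top
  have hp := mem_sqrtPowGraph_apply hL hf
  rw [sobolevNorm_eq hL hp]
  cases j with
  | zero =>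
    calc ‖dyadicPart L g 0 f‖ₑ ≤ ‖f‖ₑ := enorm_dyadicPart_le L hg 0 f
      _ ≤ ‖f‖ₑ + ‖sqrtPow L s ⟨f, hf⟩‖ₑ := le_self_add
      _ ≤ _ := by
        rw [pow_zero, ENNReal.ofReal_one, one_mul]
        exact le_mul_of_one_le_left' (ENNReal.one_le_ofReal.2 (Real.one_le_rpow one_le_two hs))
  | succ j =>
    have h1 := norm_fnSqrt_le_of_eq_zero L (isTestFn_quadPartition hg (j + 1))
      (fun l hl => abs_quadPartition_le_one hg _ hl) hs (ω := 2 ^ j) (by positivity)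
      (fun l h0 hl => quadPartition_succ_eq_zero hg h0 hl) hp
    have h2 : ((2 : ℝ) ^ j) ^ (-s) = 2 ^ s * (2 ^ (-s)) ^ (j + 1) := by
      rw [pow_succ', ← mul_assoc, ← Real.rpow_add two_pos, add_neg_cancel, Real.rpow_zero, one_mul,
        ← Real.rpow_natCast, ← Real.rpow_natCast, ← Real.rpow_mul zero_le_two,
        ← Real.rpow_mul zero_le_two, mul_comm]
    calc ‖dyadicPart L g (j + 1) f‖ₑ
        ≤ ENNReal.ofReal (((2 : ℝ) ^ j) ^ (-s)) * ‖sqrtPow L s ⟨f, hf⟩‖ₑ := by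
          rw [← ofReal_norm, ← ofReal_norm, ← ENNReal.ofReal_mul (by positivity)]
          exact ENNReal.ofReal_le_ofReal h1
      _ = ENNReal.ofReal (2 ^ s) * (ENNReal.ofReal (((2 : ℝ) ^ (-s)) ^ (j + 1)) *
            ‖sqrtPow L s ⟨f, hf⟩‖ₑ) := by
          rw [h2, ENNReal.ofReal_mul (by positivity), mul_assoc]
      _ ≤ _ := by
          gcongr
          exact le_add_self

/-- For a decomposition `f = f₀ + f₁`, use the contraction bound on `F_j(√L) f₀` and the decay
`2^(-js)` of the high-frequency piece `F_j(√L) f₁`. -/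
theorem enorm_dyadicPart_le_kFunctional {L : H →ₗ.[ℂ] H} (hL : IsNonnegSelfAdjoint L) {g : ℝ → ℝ}
    (hg : IsCutoff g) {s : ℝ} (hs : 0 ≤ s) (j : ℕ) (f : H) :
    ‖dyadicPart L g j f‖ₑ ≤ ENNReal.ofReal (2 ^ s) *
      kFunctional (fun f : H => ‖f‖ₑ) (sobolevNorm L s) f (((2 : ℝ) ^ (-s)) ^ j) := by
  have hne : ENNReal.ofReal ((2 : ℝ) ^ s) ≠ 0 := by simp; positivity
  rw [mul_comm, ← ENNReal.div_le_iff hne ENNReal.ofReal_ne_top]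
  refine le_iInf₂ fun p hp => ?_
  rw [ENNReal.div_le_iff hne ENNReal.ofReal_ne_top, mul_comm, mul_add, ← hp, map_add]
  refine (enorm_add_le _ _).trans (add_le_add ?_ (enorm_dyadicPart_le_sobolevNorm hL hg hs j p.2))
  exact (enorm_dyadicPart_le L hg j p.1).trans
    (le_mul_of_one_le_left' (ENNReal.one_le_ofReal.2 (Real.one_le_rpow one_le_two hs)))

/-- The reproducing formula, cut at order `n`, is a competitor in the `K`-functional. -/
theorem kFunctional_le_sum_dyadicPart {L : H →ₗ.[ℂ] H} (hL : IsNonnegSelfAdjoint L) {g : ℝ → ℝ}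
    (hg : IsCutoff g) {s : ℝ} (hs : 0 ≤ s) (n : ℕ) (t : ℝ) (f : H) :
    kFunctional (fun f : H => ‖f‖ₑ) (sobolevNorm L s) f t ≤
      (∑' i, ‖dyadicPart L g (i + n) f‖ₑ) + ENNReal.ofReal t *
        ∑ j ∈ Finset.range n, ENNReal.ofReal (1 + ((2 : ℝ) ^ (j + 1)) ^ s) *
          ‖dyadicPart L g j f‖ₑ := by
  set S := ∑ j ∈ Finset.range n, dyadicPart L g j (dyadicPart L g j f) with hS
  refine iInf₂_le_of_le (f - S, S) (sub_add_cancel f S)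
    (add_le_add (enorm_sub_sum_dyadicPart_le hL hg n f) ?_)
  gcongr
  calc sobolevNorm L s S
      ≤ ∑ j ∈ Finset.range n, sobolevNorm L s (dyadicPart L g j (dyadicPart L g j f)) :=
        Finset.le_sum_of_subadditive _ (sobolevNorm_zero hL s).le (sobolevNorm_add_le hL s) _ _
    _ ≤ _ := by
        refine Finset.sum_le_sum fun j _ => (sobolevNorm_dyadicPart_le hL hg hs j _).trans ?_
        gcongr
        exact enorm_dyadicPart_le L hg j _

/-! ### Sampling on dyadic pieces -/

/-- A functional that is bounded on `H ^ m` in the norm of `H` is represented there: extend it to `H`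
by Hahn-Banach and apply the Riesz theorem. -/
theorem represents_representer {L : H →ₗ.[ℂ] H} {m₀ m : ℝ} {a : (sqrtPow L m₀).domain →ₗ[ℂ] ℂ}
    {B : ℝ} (h : ∀ f : (sqrtPow L m₀).domain, (f : H) ∈ (sqrtPow L m).domain →
      ‖a f‖ ≤ B * ‖(f : H)‖) : Represents L m₀ m a (representer L m₀ m a) := by
  have hex : ∃ μ, Represents L m₀ m a μ := by
    let p : Submodule ℂ H := (sqrtPow L m₀).domain ⊓ (sqrtPow L m).domain
    let a' : StrongDual ℂ p := (a ∘ₗ Submodule.inclusion inf_le_left).mkContinuous B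
      fun f => h ⟨f, f.2.1⟩ f.2.2
    obtain ⟨b, hb, -⟩ := exists_extension_norm_eq p a'
    refine ⟨(InnerProductSpace.toDual ℂ H).symm b, fun f hf => ?_⟩
    rw [InnerProductSpace.toDual_symm_apply]
    exact hb ⟨f, f.2, hf⟩
  rw [representer, dif_pos hex]
  exact hex.choose_spec

theorem dyadicPart_mem_domain (L : H →ₗ.[ℂ] H) {g : ℝ → ℝ} (hg : IsCutoff g) {s : ℝ} (hs : 0 ≤ s)
    (j : ℕ) (f : H) : dyadicPart L g j f ∈ (sqrtPow L s).domain :=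
  mem_domain_sqrtPow (fnSqrt_mem_sqrtPowGraph L (isTestFn_quadPartition hg j) hs f)

/-- The frame coefficients of `f` are the samples of its dyadic pieces. -/
theorem inner_frameVector (L : H →ₗ.[ℂ] H) {g : ℝ → ℝ} (hg : IsCutoff g) {m₀ m : ℝ}
    (hm₀ : 0 ≤ m₀) (hm : 0 ≤ m) {a : (sqrtPow L m₀).domain →ₗ[ℂ] ℂ}
    (ha : Represents L m₀ m a (representer L m₀ m a)) (j : ℕ) (f : H) :
    inner ℂ (frameVector L m₀ m g j a) f =
      a ⟨dyadicPart L g j f, dyadicPart_mem_domain L hg hm₀ j f⟩ := by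
  rw [frameVector, samplingVector, inner_fnSqrt_left, Submodule.inner_starProjection_left_eq_right,
    Submodule.starProjection_eq_self_iff.2 (fnSqrt_mem_paleyWiener L (isTestFn_quadPartition hg j)
      (fun l hl => quadPartition_eq_zero_of_le hg hl) f)]
  exact ha ⟨dyadicPart L g j f, dyadicPart_mem_domain L hg hm₀ j f⟩
    (dyadicPart_mem_domain L hg hm j f)

theorem represents_of_isSamplingFamily {L : H →ₗ.[ℂ] H} {m₀ m c C : ℝ} (hc : 0 < c)
    {K : ℝ → Type*} {A : ∀ ρ : ℝ, K ρ → (sqrtPow L m₀).domain →ₗ[ℂ] ℂ}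
    (hA : IsSamplingFamily L m₀ m c C A) {ρ : ℝ} (hρ : ρ ∈ Set.Ioo (0 : ℝ) 1) (k : K ρ) :
    Represents L m₀ m (A ρ k) (representer L m₀ m (A ρ k)) := by
  refine represents_representer (B := √c⁻¹) fun f hf => ?_
  have h1 : ENNReal.ofReal c * ‖A ρ k f‖ₑ ^ 2 ≤ ‖(f : H)‖ₑ ^ 2 := by
    refine le_trans ?_ (hA ρ hρ f hf).1
    gcongr
    exact ENNReal.le_tsum (f := fun k => ‖A ρ k f‖ₑ ^ 2) k
  rw [← ofReal_norm, ← ofReal_norm, ← ENNReal.ofReal_pow (norm_nonneg _),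
    ← ENNReal.ofReal_pow (norm_nonneg _), ← ENNReal.ofReal_mul hc.le,
    ENNReal.ofReal_le_ofReal_iff (by positivity)] at h1
  refine le_of_sq_le_sq ?_ (by positivity)
  rw [mul_pow, Real.sq_sqrt (by positivity), inv_mul_eq_div, le_div_iff₀ hc, mul_comm]
  exact h1

/-- On a dyadic piece of order `j` the error term of the sampling inequality is at most `δ` times
the left-hand side, by the Bernstein inequality and the choice of `ρ`. Hence the frame coefficients
of order `j` measure the norm of the piece. -/
theorem tsum_inner_frameVector {L : H →ₗ.[ℂ] H} (hL : IsNonnegSelfAdjoint L) {g : ℝ → ℝ}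
    (hg : IsCutoff g) {m₀ m c C : ℝ} (hm₀ : 0 ≤ m₀) (hm : 0 ≤ m) (hc : 0 < c) (hC : 0 < C)
    {K : ℝ → Type*} {A : ∀ ρ : ℝ, K ρ → (sqrtPow L m₀).domain →ₗ[ℂ] ℂ}
    (hA : IsSamplingFamily L m₀ m c C A) {δ : ℝ} (hδ0 : 0 < δ) (hδ : δ < 1) {ρ : ℝ}
    (hρ : ρ ∈ Set.Ioo (0 : ℝ) 1) {j : ℕ}
    (hρδ : ρ ^ (2 * m) = C⁻¹ * ((2 : ℝ) ^ (j + 1)) ^ (-(2 * m)) * δ) (f : H) :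
    ENNReal.ofReal c * ∑' k, ‖inner ℂ (frameVector L m₀ m g j (A ρ k)) f‖ₑ ^ 2 ≤
        ‖dyadicPart L g j f‖ₑ ^ 2 ∧
      ENNReal.ofReal (1 - δ) * ‖dyadicPart L g j f‖ₑ ^ 2 ≤
        ENNReal.ofReal C * ∑' k, ‖inner ℂ (frameVector L m₀ m g j (A ρ k)) f‖ₑ ^ 2 := by
  simp only [inner_frameVector L hg hm₀ hm (represents_of_isSamplingFamily hc hA hρ _)]
  obtain ⟨h1, h2⟩ := hA ρ hρ ⟨dyadicPart L g j f, dyadicPart_mem_domain L hg hm₀ j f⟩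
    (dyadicPart_mem_domain L hg hm j f)
  refine ⟨h1, ?_⟩
  set S := ∑' k, ‖A ρ k ⟨dyadicPart L g j f, dyadicPart_mem_domain L hg hm₀ j f⟩‖ₑ ^ 2
  have hF := isTestFn_quadPartition hg j
  have hp := fnSqrt_mem_sqrtPowGraph L hF hm f
  have h3 := norm_fnSqrt_rpow_mul_le L hF hm (ω := 2 ^ (j + 1)) (by positivity)
    (fun l hl => quadPartition_eq_zero_of_le hg hl) f
  have h4 : sqrtPow L m ⟨dyadicPart L g j f, dyadicPart_mem_domain L hg hm j f⟩ = _ :=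
    sqrtPow_apply hL hp _
  simp only [h4] at h2
  change ‖fnSqrt L (fun l => l ^ m * quadPartition g j l) f‖ ≤ _ * ‖dyadicPart L g j f‖ at h3
  set v := dyadicPart L g j f
  set w := fnSqrt L (fun l => l ^ m * quadPartition g j l) f
  have h5 : C * (ρ ^ (2 * m) * ‖w‖ ^ 2) ≤ δ * ‖v‖ ^ 2 := by
    have h6 : ‖w‖ ^ 2 ≤ ((2 : ℝ) ^ (j + 1)) ^ (2 * m) * ‖v‖ ^ 2 := by
      rw [mul_comm 2 m, Real.rpow_mul (by positivity), Real.rpow_two, ← mul_pow]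
      gcongr
    calc C * (ρ ^ (2 * m) * ‖w‖ ^ 2)
        ≤ C * (ρ ^ (2 * m) * (((2 : ℝ) ^ (j + 1)) ^ (2 * m) * ‖v‖ ^ 2)) := by
          have := Real.rpow_nonneg hρ.1.le (2 * m)
          gcongr
      _ = δ * ‖v‖ ^ 2 := by
          rw [hρδ, Real.rpow_neg (by positivity)]
          field_simp
  have h7 : ‖v‖ₑ ^ 2 ≤ ENNReal.ofReal C * S + ENNReal.ofReal δ * ‖v‖ₑ ^ 2 := by
    refine h2.trans ?_
    rw [mul_add]
    refine add_le_add le_rfl ?_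
    have := Real.rpow_nonneg hρ.1.le (2 * m)
    rw [← ofReal_norm, ← ofReal_norm, ← ENNReal.ofReal_pow (norm_nonneg _),
      ← ENNReal.ofReal_pow (norm_nonneg _), ← ENNReal.ofReal_mul this, ← ENNReal.ofReal_mul hC.le,
      ← ENNReal.ofReal_mul hδ0.le]
    exact ENNReal.ofReal_le_ofReal h5
  have hfin : ENNReal.ofReal δ * ‖v‖ₑ ^ 2 ≠ ∞ := by finiteness
  rw [← ENNReal.add_le_add_iff_right hfin, ← add_mul,
    ← ENNReal.ofReal_add (by linarith) hδ0.le, sub_add_cancel, ENNReal.ofReal_one, one_mul]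
  exact h7

/-! ### Equivalence of the norms -/

theorem le_ofReal_sqrt_mul_of_mul_sq_le {a b : ℝ} (ha : 0 < a) (hb : 0 ≤ b) {x y : ℝ≥0∞}
    (h : ENNReal.ofReal a * x ^ 2 ≤ ENNReal.ofReal b * y ^ 2) : x ≤ ENNReal.ofReal √(b / a) * y := by
  have ha0 : ENNReal.ofReal a ≠ 0 := by simpa using ha
  rw [← ENNReal.pow_le_pow_left_iff two_ne_zero, mul_pow, ← ENNReal.ofReal_pow (Real.sqrt_nonneg _),
    Real.sq_sqrt (by positivity)]
  refine (le_inv_mul_of_mul_le ha0 ENNReal.ofReal_ne_top h).trans_eq ?_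
  rw [← mul_assoc, ← ENNReal.ofReal_inv_of_pos ha, ← ENNReal.ofReal_mul (by positivity),
    inv_mul_eq_div]

theorem rpow_le_of_le {α γ : ℝ} (hγ : γ ≤ α) {n j : ℕ} (h : n ≤ j) :
    (2 : ℝ) ^ (n * α) ≤ (2 ^ (-γ)) ^ Nat.dist n j * 2 ^ (j * α) := by
  rw [Nat.dist_eq_sub_of_le h, ← Real.rpow_natCast, ← Real.rpow_mul zero_le_two,
    ← Real.rpow_add two_pos, Nat.cast_sub h]
  refine Real.rpow_le_rpow_of_exponent_le one_le_two ?_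
  have : (n : ℝ) ≤ j := Nat.cast_le.2 h
  nlinarith

theorem rpow_mul_le_of_le {α γ s : ℝ} (hs : 0 ≤ s) (hγ : γ ≤ s - α) {n j : ℕ} (h : j ≤ n) :
    (2 : ℝ) ^ (n * α) * ((2 ^ (-s)) ^ n * (1 + ((2 : ℝ) ^ (j + 1)) ^ s)) ≤
      2 ^ (s + 1) * ((2 ^ (-γ)) ^ Nat.dist n j * 2 ^ (j * α)) := by
  have h1 : (1 : ℝ) + ((2 : ℝ) ^ (j + 1)) ^ s ≤ 2 ^ (1 + (j + 1) * s) := by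
    have h2 : (1 : ℝ) ≤ ((2 : ℝ) ^ (j + 1)) ^ s :=
      Real.one_le_rpow (one_le_pow₀ one_le_two) hs
    have h3 : ((2 : ℝ) ^ (j + 1)) ^ s = 2 ^ ((j + 1) * s) := by
      rw [← Real.rpow_natCast, ← Real.rpow_mul zero_le_two]
      push_cast
      rfl
    rw [Real.rpow_add two_pos, Real.rpow_one, ← h3]
    linarith
  calc _ ≤ (2 : ℝ) ^ (n * α) * ((2 ^ (-s)) ^ n * 2 ^ (1 + (j + 1) * s)) := by gcongr
    _ ≤ _ := by
      rw [Nat.dist_eq_sub_of_le_right h, ← Real.rpow_natCast, ← Real.rpow_natCast,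
        ← Real.rpow_mul zero_le_two, ← Real.rpow_mul zero_le_two, ← Real.rpow_add two_pos,
        ← Real.rpow_add two_pos, ← Real.rpow_add two_pos, ← Real.rpow_add two_pos, Nat.cast_sub h]
      refine Real.rpow_le_rpow_of_exponent_le one_le_two ?_
      have : (j : ℝ) ≤ n := Nat.cast_le.2 h
      nlinarith

theorem two_rpow_neg_pow_rpow {s α : ℝ} (hs : s ≠ 0) (n : ℕ) :
    (((2 : ℝ) ^ (-s)) ^ n) ^ (-(α / s)) = 2 ^ (n * α) := by
  rw [← Real.rpow_natCast, ← Real.rpow_mul zero_le_two, ← Real.rpow_mul zero_le_two]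
  congr 1
  field_simp

/-- The weighted norms `2^(jα) ‖F_j(√L) f‖` of the dyadic pieces, whose `ℓ^q` norm is a
Littlewood-Paley form of the Besov norm. -/
noncomputable def weightedPart (L : H →ₗ.[ℂ] H) (g : ℝ → ℝ) (α : ℝ) (f : H) (j : ℕ) : ℝ≥0∞ :=
  ENNReal.ofReal (2 ^ (j * α)) * ‖dyadicPart L g j f‖ₑ

/-- At `t = 2^(-ns)` the weighted `K`-functional is bounded by a geometrically decaying average of the
weighted pieces. The decay `γ` must not exceed `α`, for the pieces of order above `n`, nor `s - α`,
for those of order up to `n`. -/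
theorem mul_kFunctional_le_tsum {L : H →ₗ.[ℂ] H} (hL : IsNonnegSelfAdjoint L) {g : ℝ → ℝ}
    (hg : IsCutoff g) {s α γ : ℝ} (hs : 0 ≤ s) (hγ : γ ≤ α) (hγ' : γ ≤ s - α) (n : ℕ) (f : H) :
    ENNReal.ofReal (2 ^ (n * α)) *
        kFunctional (fun f : H => ‖f‖ₑ) (sobolevNorm L s) f ((2 ^ (-s)) ^ n) ≤
      ENNReal.ofReal (2 ^ (s + 1)) *
        ∑' j, ENNReal.ofReal (2 ^ (-γ)) ^ Nat.dist n j * weightedPart L g α f j := by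
  set β : ℝ := 2 ^ (-γ) with hβ
  have hβ0 : 0 ≤ β := by positivity
  have hone : 1 ≤ ENNReal.ofReal (2 ^ (s + 1)) :=
    ENNReal.one_le_ofReal.2 (Real.one_le_rpow one_le_two (by linarith))
  have hterm : ∀ j, ENNReal.ofReal β ^ Nat.dist n j * weightedPart L g α f j =
      ENNReal.ofReal (β ^ Nat.dist n j * 2 ^ (j * α)) * ‖dyadicPart L g j f‖ₑ := by
    intro j
    rw [weightedPart, ← ENNReal.ofReal_pow hβ0, ← mul_assoc, ENNReal.ofReal_mul (by positivity)]
  simp_rw [hterm]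
  rw [← ENNReal.summable.sum_add_tsum_nat_add' (k := n + 1), mul_add, add_comm]
  refine (mul_le_mul_right (kFunctional_le_sum_dyadicPart hL hg hs (n + 1) _ f) _).trans ?_
  rw [mul_add]
  refine add_le_add ?_ ?_
  · refine le_trans ?_ (le_mul_of_one_le_left' hone)
    rw [← ENNReal.tsum_mul_left]
    gcongr with i
    exact rpow_le_of_le hγ (by omega)
  · rw [← mul_assoc, Finset.mul_sum, Finset.mul_sum]
    refine Finset.sum_le_sum fun j hj => ?_
    have hjn : j ≤ n := Nat.lt_succ_iff.1 (Finset.mem_range.1 hj)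
    rw [← mul_assoc, ← mul_assoc, ← ENNReal.ofReal_mul (by positivity),
      ← ENNReal.ofReal_mul (by positivity), ← ENNReal.ofReal_mul (by positivity), mul_assoc]
    exact mul_le_mul_left (ENNReal.ofReal_le_ofReal (rpow_mul_le_of_le hs hγ' hjn)) _

theorem kFunctional_le_tsum_weightedPart {L : H →ₗ.[ℂ] H} (hL : IsNonnegSelfAdjoint L)
    {g : ℝ → ℝ} (hg : IsCutoff g) {s α γ : ℝ} (hs : 0 ≤ s) (hγ : γ ≤ α) (t : ℝ) (f : H) :
    kFunctional (fun f : H => ‖f‖ₑ) (sobolevNorm L s) f t ≤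
      ∑' j, ENNReal.ofReal (2 ^ (-γ)) ^ Nat.dist 0 j * weightedPart L g α f j := by
  refine (kFunctional_le_sum_dyadicPart hL hg hs 0 t f).trans ?_
  rw [Finset.sum_range_zero, mul_zero, add_zero]
  refine ENNReal.tsum_le_tsum fun j => ?_
  rw [weightedPart, ← ENNReal.ofReal_pow (by positivity), ← mul_assoc,
    ← ENNReal.ofReal_mul (by positivity)]
  refine le_mul_of_one_le_left' (ENNReal.one_le_ofReal.2 ?_)
  simpa using rpow_le_of_le hγ (Nat.zero_le j)

theorem exists_besovNorm_le {L : H →ₗ.[ℂ] H} (hL : IsNonnegSelfAdjoint L) {g : ℝ → ℝ}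
    (hg : IsCutoff g) {α : ℝ} (hα : 0 < α) {r : ℕ} (hr : α < r) {q : ℝ≥0∞} (hq : 1 ≤ q) :
    ∃ D : ℝ≥0∞, D ≠ ∞ ∧ ∀ f : H,
      besovNorm L r α q f ≤ D * lqNorm q (weightedPart L g α f) := by
  have hr0 : (0 : ℝ) < r := hα.trans hr
  obtain ⟨D, hD, h⟩ := exists_interpolationNorm_le (fun f : H => ‖f‖ₑ) (sobolevNorm L r)
    (b := 2 ^ (-(r : ℝ))) (θ := α / r) (by positivity)
    (Real.rpow_lt_one_of_one_lt_of_neg one_lt_two (by linarith)) (by positivity) hq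
  -- The decay rate of the kernel on either side of the diagonal is `α` or `r - α`.
  set γ := min α (r - α) with hγ
  have hγ0 : 0 < γ := lt_min hα (by linarith)
  set β := ENNReal.ofReal (2 ^ (-γ)) with hβ
  have hβ1 : β < 1 := by
    rw [hβ, ENNReal.ofReal_lt_one]
    exact Real.rpow_lt_one_of_one_lt_of_neg one_lt_two (by linarith)
  set E := ENNReal.ofReal ((2 : ℝ) ^ ((r : ℝ) + 1)) with hE
  have hM : 2 * (1 - β)⁻¹ ≠ ∞ :=
    ENNReal.mul_ne_top (by simp) (ENNReal.inv_ne_top.2 (tsub_pos_of_lt hβ1).ne')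
  refine ⟨D * (E * (2 * (1 - β)⁻¹)),
    ENNReal.mul_ne_top hD (ENNReal.mul_ne_top ENNReal.ofReal_ne_top hM), fun f => ?_⟩
  refine (h f (fun n => E * ∑' j, β ^ Nat.dist n j * weightedPart L g α f j)
    (fun n => ?_) fun t => ?_).trans ?_
  · rw [two_rpow_neg_pow_rpow hr0.ne']
    exact mul_kFunctional_le_tsum hL hg hr0.le (min_le_left _ _) (min_le_right _ _) n f
  · refine (kFunctional_le_tsum_weightedPart hL hg hr0.le (min_le_left α (r - α)) t f).trans ?_
    exact le_mul_of_one_le_left'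
      (ENNReal.one_le_ofReal.2 (Real.one_le_rpow one_le_two (by linarith)))
  · rw [lqNorm_const_mul hq, mul_assoc, mul_assoc]
    gcongr
    exact lqNorm_tsum_pow_dist_mul_le hq β _

theorem exists_lqNorm_weightedPart_le {L : H →ₗ.[ℂ] H} (hL : IsNonnegSelfAdjoint L) {g : ℝ → ℝ}
    (hg : IsCutoff g) {α : ℝ} (hα : 0 < α) {r : ℕ} (hr : α < r) {q : ℝ≥0∞} (hq : 1 ≤ q) :
    ∃ D : ℝ≥0∞, D ≠ ∞ ∧ ∀ f : H,
      lqNorm q (weightedPart L g α f) ≤ D * besovNorm L r α q f := by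
  have hr0 : (0 : ℝ) < r := hα.trans hr
  obtain ⟨D, hD, h⟩ := exists_lqNorm_kFunctional_le (fun f : H => ‖f‖ₑ) (sobolevNorm L r)
    (b := 2 ^ (-(r : ℝ))) (θ := α / r) (by positivity)
    (Real.rpow_lt_one_of_one_lt_of_neg one_lt_two (by linarith)) (by positivity) hq
  refine ⟨ENNReal.ofReal (2 ^ (r : ℝ)) * D, ENNReal.mul_ne_top ENNReal.ofReal_ne_top hD,
    fun f => ?_⟩
  rw [mul_assoc]
  refine le_trans ?_ (mul_le_mul_right (h f) _)
  rw [← lqNorm_const_mul hq]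
  refine lqNorm_mono fun j => ?_
  rw [two_rpow_neg_pow_rpow hr0.ne', weightedPart, mul_left_comm]
  gcongr
  exact enorm_dyadicPart_le_kFunctional hL hg hr0.le j f

theorem exists_ofReal_mul_le {D : ℝ≥0∞} (hD : D ≠ ∞) :
    ∃ c : ℝ, 0 < c ∧ ENNReal.ofReal c * D ≤ 1 := by
  have h0 : 0 < D.toReal + 1 := by positivity
  refine ⟨(D.toReal + 1)⁻¹, by positivity, ?_⟩
  rw [← ENNReal.ofReal_toReal hD, ← ENNReal.ofReal_mul (by positivity), ENNReal.ofReal_le_one,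
    inv_mul_le_one₀ (by rw [ENNReal.toReal_ofReal ENNReal.toReal_nonneg]; exact h0),
    ENNReal.toReal_ofReal ENNReal.toReal_nonneg]
  linarith

end PaleyWiener

theorem theorem7p5 {H : Type*} [NormedAddCommGroup H] [InnerProductSpace ℂ H] [CompleteSpace H]
    (L : H →ₗ.[ℂ] H) (hL : PaleyWiener.IsNonnegSelfAdjoint L)
    (g : ℝ → ℝ) (hg : PaleyWiener.IsCutoff g)
    (m₀ m c C : ℝ) (hm₀ : 0 ≤ m₀) (hm : m₀ < m) (hc : 0 < c) (hC : 0 < C)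
    {K : ℝ → Type*} (A : ∀ ρ : ℝ, K ρ → (PaleyWiener.sqrtPow L m₀).domain →ₗ[ℂ] ℂ)
    (hA : PaleyWiener.IsSamplingFamily L m₀ m c C A)
    (δ : ℝ) (hδ : δ ∈ Set.Ioo (0 : ℝ) 1)
    (ρ : ℕ → ℝ) (hρ : ∀ j, ρ j ∈ Set.Ioo (0 : ℝ) 1)
    (hρδ : ∀ j, ρ j ^ (2 * m) = C⁻¹ * ((2 : ℝ) ^ (j + 1)) ^ (-(2 * m)) * δ)
    (α : ℝ) (hα : 0 < α) (r : ℕ) (hr : α < r) (q : ℝ≥0∞) (hq : 1 ≤ q) :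
    ∃ c₁ c₂ : ℝ, 0 < c₁ ∧ 0 < c₂ ∧ ∀ f : H,
      ENNReal.ofReal c₁ * PaleyWiener.besovNorm L r α q f ≤
        PaleyWiener.coefficientNorm
          (fun j (k : K (ρ j)) => PaleyWiener.frameVector L m₀ m g j (A (ρ j) k)) α q f ∧
      PaleyWiener.coefficientNorm
          (fun j (k : K (ρ j)) => PaleyWiener.frameVector L m₀ m g j (A (ρ j) k)) α q f ≤
        ENNReal.ofReal c₂ * PaleyWiener.besovNorm L r α q f := by
  obtain ⟨D₁, hD₁, h₁⟩ := PaleyWiener.exists_besovNorm_le hL hg hα hr hq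
  obtain ⟨D₂, hD₂, h₂⟩ := PaleyWiener.exists_lqNorm_weightedPart_le hL hg hα hr hq
  set E₁ := ENNReal.ofReal √(C / (1 - δ))
  set E₂ := ENNReal.ofReal √(1 / c)
  set x : H → ℕ → ℝ≥0∞ := fun f j => (∑' k : K (ρ j),
    ‖inner ℂ (PaleyWiener.frameVector L m₀ m g j (A (ρ j) k)) f‖ₑ ^ 2) ^ (1 / 2 : ℝ) with hx
  have hxsq : ∀ f j, x f j ^ 2 = ∑' k : K (ρ j),
      ‖inner ℂ (PaleyWiener.frameVector L m₀ m g j (A (ρ j) k)) f‖ₑ ^ 2 := by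
    intro f j
    rw [hx, ← ENNReal.rpow_natCast, ← ENNReal.rpow_mul]
    norm_num
  have hframe : ∀ f j, PaleyWiener.weightedPart L g α f j ≤
        E₁ * (ENNReal.ofReal (2 ^ (j * α)) * x f j) ∧
      ENNReal.ofReal (2 ^ (j * α)) * x f j ≤ E₂ * PaleyWiener.weightedPart L g α f j := by
    intro f j
    obtain ⟨h3, h4⟩ := PaleyWiener.tsum_inner_frameVector hL hg hm₀ (hm₀.trans hm.le) hc hC hA
      hδ.1 hδ.2 (hρ j) (hρδ j) f
    rw [← hxsq] at h3 h4
    rw [PaleyWiener.weightedPart, mul_left_comm, mul_left_comm E₂]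
    constructor
    · gcongr
      exact PaleyWiener.le_ofReal_sqrt_mul_of_mul_sq_le (by linarith [hδ.2]) hC.le h4
    · gcongr
      exact PaleyWiener.le_ofReal_sqrt_mul_of_mul_sq_le hc zero_le_one (by simpa using h3)
  obtain ⟨c₁, hc₁, hcD⟩ := PaleyWiener.exists_ofReal_mul_le
    (ENNReal.mul_ne_top hD₁ (ENNReal.ofReal_ne_top (r := √(C / (1 - δ)))))
  have hD : E₂ * D₂ ≠ ∞ := ENNReal.mul_ne_top ENNReal.ofReal_ne_top hD₂
  refine ⟨c₁, (E₂ * D₂).toReal + 1, hc₁, by positivity, fun f => ?_⟩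
  rw [PaleyWiener.coefficientNorm_eq_lqNorm _ _ hq]
  set N := PaleyWiener.lqNorm q fun j => ENNReal.ofReal (2 ^ (j * α)) * x f j
  have hN₁ : PaleyWiener.lqNorm q (PaleyWiener.weightedPart L g α f) ≤ E₁ * N := by
    rw [← PaleyWiener.lqNorm_const_mul hq]
    exact PaleyWiener.lqNorm_mono fun j => (hframe f j).1
  have hN₂ : N ≤ E₂ * PaleyWiener.lqNorm q (PaleyWiener.weightedPart L g α f) := by
    rw [← PaleyWiener.lqNorm_const_mul hq]
    exact PaleyWiener.lqNorm_mono fun j => (hframe f j).2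
  constructor
  · calc ENNReal.ofReal c₁ * PaleyWiener.besovNorm L r α q f
        ≤ ENNReal.ofReal c₁ * (D₁ * (E₁ * N)) := by
          gcongr
          exact (h₁ f).trans (by gcongr)
      _ = ENNReal.ofReal c₁ * (D₁ * E₁) * N := by ring
      _ ≤ 1 * N := by gcongr
      _ = N := one_mul N
  · calc N ≤ E₂ * (D₂ * PaleyWiener.besovNorm L r α q f) :=
          hN₂.trans (by gcongr; exact h₂ f)
      _ = E₂ * D₂ * PaleyWiener.besovNorm L r α q f := by ring
      _ ≤ _ := by
          gcongr
          rw [ENNReal.ofReal_add ENNReal.toReal_nonneg zero_le_one, ENNReal.ofReal_toReal hD]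
          exact le_self_add
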